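/- All rings are commutative with identity. An ideal $I$ of a domain $R$ is *stable* if it is projective as a module over its endomorphism ring $\mathrm{End}_R(I)$, and $R$ is *stable* if every nonzero ideal of $R$ is stable. A *bad stable domain* is a quasilocal (i.e. having a unique maximal ideal, not necessarily Noetherian) stable domain of Krull dimension $1$ whose integral closure in its quotient field is not a finitely generated $R$-module. An $R$-module $K$ over a domain $R$ is *divisible* if $rK=K$ for every nonzero $r\in R$, and *uniserial* if its submodules are linearly ordered by inclusion. **Theorem.** Let $R$ be a quasilocal domain that is not a DVR, let $F$ be its quotient field, and let $\overline{R}$ be the integral closure of $R$ in $F$. The following are equivalent: 1. $R$ is a bad stable domain. 2. $\overline{R}$ is a DVR and $\overline{R}/R \cong \bigoplus_{i\in I} F/\overline{R}$ as $R$-modules for some index set $I$. 3. $\overline{R}$ is a DVR and $\overline{R}/R$ is a direct sum of divisible Artinian uniserial $R$-modules. -/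

import Mathlib

universe u v

open scoped DirectSum

/-- An ideal `I` is stable if it is projective as a module over its ring of endomorphisms. -/
def Ideal.IsStableIdeal {R : Type*} [CommRing R] (I : Ideal R) : Prop :=
  Module.Projective (Module.End R I) I

/-- A stable ring (used for domains): every nonzero ideal is stable. -/
def IsStableRing (R : Type*) [CommRing R] : Prop :=
  ∀ I : Ideal R, I ≠ ⊥ → I.IsStableIdeal

/-- `R` has finite normalization if its integral closure in its total ring of quotients
is a finite `R`-module. -/
def HasFiniteNormalization (R : Type*) [CommRing R] : Prop :=
  Module.Finite R (integralClosure R (FractionRing R))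

/-- A bad stable domain: a quasilocal stable domain of Krull dimension `1`
without finite normalization. -/
structure IsBadStableDomain (R : Type*) [CommRing R] : Prop where
  isDomain : IsDomain R
  isLocalRing : IsLocalRing R
  isStableRing : IsStableRing R
  ringKrullDim_eq_one : ringKrullDim R = 1
  not_hasFiniteNormalization : ¬ HasFiniteNormalization R

/-- A module is divisible if every nonzerodivisor of the ring acts surjectively on it. -/
def IsDivisibleModule (R : Type*) [CommRing R] (K : Type*) [AddCommGroup K] [Module R K] : Prop :=
  ∀ r ∈ nonZeroDivisors R, ∀ x : K, ∃ y : K, x = r • y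

/-- A module is uniserial if its submodules are linearly ordered by inclusion. -/
def IsUniserialModule (R : Type*) [CommRing R] (K : Type*) [AddCommGroup K] [Module R K] : Prop :=
  ∀ A B : Submodule R K, A ≤ B ∨ B ≤ A

/-- The `R`-module `R̄/R`, where `R̄` is the integral closure of `R` in `F`. -/
abbrev NormalizationModSelf (R F : Type*) [CommRing R] [Field F] [Algebra R F] : Type _ :=
  integralClosure R F ⧸ LinearMap.range (Algebra.linearMap R (integralClosure R F))

/-- The `R`-module `F/R̄`, where `R̄` is the integral closure of `R` in `F`. -/
abbrev FieldModNormalization (R F : Type*) [CommRing R] [Field F] [Algebra R F] : Type _ :=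
  F ⧸ Subalgebra.toSubmodule (integralClosure R F)

/-- `L` is the (internal) direct sum of a family of divisible Artinian uniserial submodules. -/
def IsDirectSumOfDivisibleArtinianUniserial (R : Type*) [CommRing R]
    {L : Type*} [AddCommGroup L] [Module R L] {ι : Type*} [DecidableEq ι]
    (N : ι → Submodule R L) : Prop :=
  DirectSum.IsInternal N ∧
    ∀ i, IsDivisibleModule R (N i) ∧ IsArtinian R (N i) ∧ IsUniserialModule R (N i)

/-! Write `V` for the integral closure of `R` in `F`. All three conditions are equivalent to a
fourth, `HasDivisibleValuativeNormalization`: `V` is a DVR, `V/R` is divisible, and annihilators in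
`V/R` obey the valuation, so that `b ∣ c` in `V` and `b x = 0` force `c x = 0`.

Bad stable domains satisfy it. Stability makes a nonzero finitely generated `J ⊆ F` invertible over
its multiplier ring `E`. This ring is finite over the local ring `R`, hence semilocal, so `J = eE`.
Therefore the `R`-span of `1, x, z` is a ring for all `x, z ∈ V`, and two-generated submodules of
`V` are principal over overrings. Under these two properties `V` is a valuation ring with `V = R +
M`, where `M = cV` is its maximal ideal and `c ∈ R`: each possible failure of locality, of `V = R +
M` or of `M = cV` forces `V = R[x]` for one `x`, so that `V` would be finite. Then `V = R + c^n V`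
for all `n`, which is divisibility. Stability of the ideals `bV ∩ R` gives the annihilator
condition.

Conversely, let `b` have least value in an ideal `I`. Divisibility moves any element of `I` into
`b²V` by subtracting a multiple of `b`, and the annihilator condition puts the product of two such
elements into `b²R`. Hence `I² = bI`, and `I` is free of rank one over its endomorphism ring. If `V`
were finite, divisibility would give `V = R`.

For the module structure, a divisible torsion module with this annihilator condition is controlled
by its socle: each socle vector extends to a map from `F/V`, and a socle basis gives an isomorphism
from a direct sum of copies of `F/V` (`exists_linearEquiv_directSum`). In a divisible uniserial
module the annihilators define a valuation ring containing `R`, hence `V`, which returns the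
annihilator condition. -/

/-- A finite dual basis exhibiting `J` as an invertible module over its own endomorphism ring
`{q | q J ⊆ J}`: the functionals are multiplications by elements `q` with `q J ⊆ (J : J)`. -/
def HasStableDualBasis {R F : Type*} [CommRing R] [Field F] [Algebra R F]
    (J : Submodule R F) : Prop :=
  ∃ (n : ℕ) (x q : Fin n → F), (∀ j, x j ∈ J) ∧ ∑ j, q j * x j = 1 ∧
    ∀ j, ∀ y ∈ J, ∀ z ∈ J, q j * y * z ∈ J

/-! ### Multiplier rings of submodules of the quotient field -/

section Multiplier

variable {R : Type u} {F : Type v} [CommRing R] [Field F] [Algebra R F]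

theorem HasStableDualBasis.of_map_mul {J K : Submodule R F} {d : F} (hd : d ≠ 0)
    (h : ∀ y, y ∈ J ↔ d * y ∈ K) (hK : HasStableDualBasis K) : HasStableDualBasis J := by
  obtain ⟨n, x, q, hx, hxq, hq⟩ := hK
  refine ⟨n, fun j => d⁻¹ * x j, fun j => d * q j, ?_, ?_, ?_⟩
  · intro j; rw [h, mul_inv_cancel_left₀ hd]; exact hx j
  · rw [← hxq]
    refine Finset.sum_congr rfl fun j _ => ?_
    field_simp
  · intro j y hy z hz
    rw [h] at hy hz ⊢
    have := hq j _ hy _ hz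
    convert this using 1
    ring

/-- The ring of multipliers of an `R`-submodule of `F`. -/
def multiplierRing (J : Submodule R F) : Subalgebra R F where
  carrier := {e | ∀ y ∈ J, e * y ∈ J}
  mul_mem' := fun {a b} ha hb y hy => by rw [mul_assoc]; exact ha _ (hb _ hy)
  add_mem' := fun {a b} ha hb y hy => by rw [add_mul]; exact J.add_mem (ha _ hy) (hb _ hy)
  algebraMap_mem' := fun r y hy => by rw [← Algebra.smul_def]; exact J.smul_mem _ hy

theorem isIntegral_of_mem_multiplierRing [IsFractionRing R F] {J : Submodule R F}
    (hJ : J ≠ ⊥) (hfg : J.FG) {e : F}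
    (he : e ∈ multiplierRing J) : IsIntegral R e := by
  have : FaithfulSMul R F := (faithfulSMul_iff_algebraMap_injective R F).mpr
    (IsFractionRing.injective R F)
  exact isIntegral_of_smul_mem_submodule J hJ hfg e (fun n hn => he n hn)

/-- Since `e = ∑ q_j (e x_j)`, the multiplier ring is the sum of the finitely many modules `q_j J`.
-/
theorem HasStableDualBasis.finite_multiplierRing {J : Submodule R F} (h : HasStableDualBasis J)
    (hfg : J.FG) : Module.Finite R (multiplierRing J) := by
  obtain ⟨n, x, q, hx, hxq, hq⟩ := h
  have : Subalgebra.toSubmodule (multiplierRing J)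
      = ⨆ j, Submodule.map (LinearMap.mulLeft R (q j)) J := by
    apply le_antisymm
    · intro e he
      have he' : e = ∑ j, q j * (e * x j) := by
        calc e = e * 1 := (mul_one e).symm
          _ = _ := by
            rw [← hxq, Finset.mul_sum]
            exact Finset.sum_congr rfl fun j _ => by ring
      rw [he']
      refine Submodule.sum_mem _ fun j _ => Submodule.mem_iSup_of_mem j ?_
      exact ⟨e * x j, he _ (hx j), rfl⟩
    · refine iSup_le fun j => ?_
      rintro _ ⟨y, hy, rfl⟩ z hz
      exact hq j y hy z hz
  refine Module.Finite.iff_fg.mpr (?_ : (Subalgebra.toSubmodule (multiplierRing J)).FG)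
  rw [this]
  exact Submodule.fg_iSup _ fun j => hfg.map _

end Multiplier

theorem Module.Finite.finite_setOf_isMaximal (R : Type*) [CommRing R] [IsLocalRing R]
    (E : Type*) [CommRing E] [Algebra R E]
    [Module.Finite R E] : {I : Ideal E | I.IsMaximal}.Finite := by
  refine (Algebra.QuasiFinite.finite_primesOver (S := E) (IsLocalRing.maximalIdeal R)).subset ?_
  intro I hI
  have hI : I.IsMaximal := hI
  refine ⟨hI.isPrime, ⟨?_⟩⟩
  exact (IsLocalRing.eq_maximalIdeal
    (Ideal.isMaximal_comap_of_isIntegral_of_isMaximal (R := R) I)).symm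

/-! ### From projectivity over the endomorphism ring to generators -/

section DualBasis

variable {R : Type u} {F : Type v} [CommRing R] [IsDomain R] [Field F] [Algebra R F]
  [IsFractionRing R F]

/-- Endomorphisms of `I` are multiplications by elements of `F`. A section `s` of the canonical
surjection from a free module is determined by its value at one nonzero `a`, and that value has
finite support, so finitely many functionals suffice even when `I` is not finitely generated. -/
theorem Ideal.IsStableIdeal.hasStableDualBasis {I : Ideal R} (h : I.IsStableIdeal) (hI : I ≠ ⊥) :
    HasStableDualBasis (Submodule.map (Algebra.linearMap R F) I) := by
  obtain ⟨a, haI, ha⟩ := Submodule.exists_mem_ne_zero_of_ne_bot hI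
  obtain ⟨s, hs⟩ := (Module.projective_def'.mp h)
  have ha' : algebraMap R F a ≠ 0 := by
    simpa using (map_ne_zero_iff _ (IsFractionRing.injective R F)).mpr ha
  let a' : I := ⟨a, haI⟩
  let θ : Module.End R I → F := fun f => algebraMap R F (f a') / algebraMap R F a
  have hcomm : ∀ (f : Module.End R I) (y z : I), (y : R) * (f z : R) = (z : R) * (f y : R) := by
    intro f y z
    have h1 : (y : R) • z = (z : R) • y := by ext; simp [mul_comm]
    have h2 := congrArg f h1
    rw [map_smul, map_smul] at h2
    simpa using congrArg Subtype.val h2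
  have hθ : ∀ (f : Module.End R I) (y : I), algebraMap R F (f y) = θ f * algebraMap R F y := by
    intro f y
    simp only [θ]
    rw [div_mul_eq_mul_div, eq_div_iff ha', ← map_mul, ← map_mul, mul_comm, hcomm f a' y,
      mul_comm]
  let μ : R → Module.End R I := fun r => LinearMap.lsmul R I r
  have hμ : ∀ (r : R) (y : I), μ r y = r • y := fun r y => rfl
  -- The `j`-th coordinate of `s` is proportional to its argument; this makes `q_j * y` the
  -- multiplier of the endomorphism `s y j`.
  have hsy : ∀ (y j : I), a * (s y j a' : R) = y * (s a' j a' : R) := by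
    intro y j
    have h1 : μ a • y = μ y • a' := by
      ext; simp [μ, a', mul_comm]
    have h2 := congrArg s h1
    rw [map_smul, map_smul] at h2
    have h3 := congrArg (fun t => ((t j) a' : R)) h2
    simpa [hμ] using h3
  let e := (s a').support.equivFin
  refine ⟨(s a').support.card, fun j => algebraMap R F ((e.symm j : I) : R),
    fun j => θ (s a' (e.symm j)) / algebraMap R F a, ?_, ?_, ?_⟩
  · intro j
    exact ⟨_, (e.symm j : I).2, rfl⟩
  · have h1 := LinearMap.congr_fun hs a'
    simp only [LinearMap.comp_apply, LinearMap.id_apply, Finsupp.linearCombination_apply,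
      Finsupp.sum, id] at h1
    have h2 := congrArg (fun t : I => algebraMap R F (t : R)) h1
    simp only [AddSubmonoidClass.coe_finsetSum, map_sum, Module.End.smul_def, hθ] at h2
    rw [e.symm.sum_comp (fun j : (s a').support =>
      θ (s a' j) / algebraMap R F a * algebraMap R F ((j : I) : R)),
      Finset.sum_coe_sort (s a').support
        (fun j : I => θ (s a' j) / algebraMap R F a * algebraMap R F (j : R))]
    have h3 : ∀ j : I, θ (s a' j) / algebraMap R F a * algebraMap R F (j : R)
        = (θ (s a' j) * algebraMap R F (j : R)) / algebraMap R F a := fun j => by ring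
    simp only [h3]
    rw [← Finset.sum_div, h2]
    exact div_self ha'
  · rintro j _ ⟨y, hy, rfl⟩ _ ⟨z, hz, rfl⟩
    refine ⟨(s ⟨y, hy⟩ (e.symm j) ⟨z, hz⟩ : I), Subtype.coe_prop _, ?_⟩
    simp only [Algebra.linearMap_apply]
    rw [hθ]
    congr 1
    simp only [θ]
    have h1 := congrArg (algebraMap R F) (hsy ⟨y, hy⟩ (e.symm j))
    simp only [map_mul] at h1
    field_simp
    rw [mul_comm] at h1
    exact h1.trans (mul_comm _ _)

theorem IsStableRing.hasStableDualBasis (hR : IsStableRing R) {J : Submodule R F} (hJ : J ≠ ⊥)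
    {d : R} (hd : d ≠ 0) (hdJ : ∀ y ∈ J, ∃ r : R, algebraMap R F r = algebraMap R F d * y) :
    HasStableDualBasis J := by
  have hd' : algebraMap R F d ≠ 0 := by
    simpa using (map_ne_zero_iff _ (IsFractionRing.injective R F)).mpr hd
  let I : Ideal R := Submodule.comap (Algebra.linearMap R F)
    (J.map (LinearMap.mulLeft R (algebraMap R F d)))
  have hmem : ∀ y, y ∈ J ↔ algebraMap R F d * y ∈ Submodule.map (Algebra.linearMap R F) I := by
    intro y
    constructor
    · intro hy
      obtain ⟨r, hr⟩ := hdJ y hy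
      refine ⟨r, ?_, hr⟩
      exact ⟨y, hy, hr.symm⟩
    · rintro ⟨r, hr, hry⟩
      obtain ⟨z, hz, hzr⟩ := hr
      have : z = y := by
        apply mul_left_cancel₀ hd'
        rw [← hry, ← hzr]
        rfl
      rwa [← this]
  have hI : I ≠ ⊥ := by
    obtain ⟨y, hy, hy0⟩ := Submodule.exists_mem_ne_zero_of_ne_bot hJ
    rw [hmem] at hy
    intro hbot
    rw [hbot, Submodule.map_bot, Submodule.mem_bot] at hy
    exact mul_ne_zero hd' hy0 hy
  exact ((hR I hI).hasStableDualBasis hI).of_map_mul hd' hmem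

theorem IsStableRing.hasStableDualBasis_of_fg (hR : IsStableRing R) {J : Submodule R F}
    (hJ : J ≠ ⊥) (hfg : J.FG) : HasStableDualBasis J := by
  obtain ⟨d, hd, h⟩ := FractionalIdeal.isFractional_of_fg (S := nonZeroDivisors R) hfg
  refine hR.hasStableDualBasis hJ (nonZeroDivisors.ne_zero hd) fun y hy => ?_
  obtain ⟨r, hr⟩ := h y hy
  exact ⟨r, by rw [hr, Algebra.smul_def]⟩

/-- Finitely generated modules over a local stable domain are principal over their multiplier
ring. -/
theorem IsStableRing.exists_generator_of_fg [IsLocalRing R] (hR : IsStableRing R)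
    {J : Submodule R F} (hJ : J ≠ ⊥) (hfg : J.FG) :
    ∃ e ∈ J, e ≠ 0 ∧ ∀ y ∈ J, ∀ z ∈ J, y * z / e ∈ J := by
  have hb := hR.hasStableDualBasis_of_fg hJ hfg
  have hfin := hb.finite_multiplierRing hfg
  obtain ⟨n, x, q, hx, hxq, hq⟩ := hb
  set E := multiplierRing J with hE
  have hfrac : IsFractionRing E F := by
    refine IsFractionRing.of_field E F fun z => ?_
    obtain ⟨a, b, hb, rfl⟩ := IsFractionRing.div_surjective (A := R) z
    exact ⟨algebraMap R E a, algebraMap R E b, rfl⟩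
  let A : FractionalIdeal (nonZeroDivisors E) F :=
    ⟨Submodule.span E (Set.range x),
      FractionalIdeal.isFractional_of_fg (Submodule.fg_span (Set.finite_range x))⟩
  let B : FractionalIdeal (nonZeroDivisors E) F :=
    ⟨Submodule.span E (Set.range q),
      FractionalIdeal.isFractional_of_fg (Submodule.fg_span (Set.finite_range q))⟩
  have hAB : A * B = 1 := by
    rw [FractionalIdeal.coe_ext_iff, FractionalIdeal.coe_mul, FractionalIdeal.coe_one]
    change Submodule.span E (Set.range x) * Submodule.span E (Set.range q) = 1
    apply le_antisymm
    · rw [Submodule.span_mul_span, Submodule.span_le]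
      rintro _ ⟨_, ⟨i, rfl⟩, _, ⟨j, rfl⟩, rfl⟩
      refine Submodule.mem_one.mpr ⟨⟨x i * q j, fun y hy => ?_⟩, rfl⟩
      have := hq j _ (hx i) _ hy
      convert this using 1
      ring
    · rw [Submodule.one_le, ← hxq]
      refine Submodule.sum_mem _ fun j _ => ?_
      rw [mul_comm]
      exact Submodule.mul_mem_mul (Submodule.subset_span ⟨j, rfl⟩)
        (Submodule.subset_span ⟨j, rfl⟩)
  -- `E` is semilocal, being finite over a local ring, so its invertible fractional ideals are
  -- principal.
  have hprin := FractionalIdeal.isPrincipal.of_finite_maximals_of_inv le_rfl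
    (Module.Finite.finite_setOf_isMaximal R E) A B hAB
  obtain ⟨e, he⟩ := hprin.principal
  change Submodule.span E (Set.range x) = _ at he
  have hspan : ∀ w ∈ Submodule.span E (Set.range x), w ∈ J := by
    intro w hw
    induction hw using Submodule.span_induction with
    | mem w hw => obtain ⟨j, rfl⟩ := hw; exact hx j
    | zero => exact J.zero_mem
    | add a b _ _ ha hb => exact J.add_mem ha hb
    | smul c a _ ha => exact c.2 a ha
  have hJe : ∀ y ∈ J, ∃ c ∈ E, y = c * e := by
    intro y hy
    have h1 : y ∈ Submodule.span E (Set.range x) := by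
      have : y = ∑ j, (⟨q j * y, fun z hz => hq j y hy z hz⟩ : E) • x j := by
        calc y = y * 1 := (mul_one y).symm
          _ = _ := by
            rw [← hxq, Finset.mul_sum]
            refine Finset.sum_congr rfl fun j _ => ?_
            rw [Subalgebra.smul_def, smul_eq_mul]
            ring
      rw [this]
      exact Submodule.sum_mem _ fun j _ => Submodule.smul_mem _ _ (Submodule.subset_span ⟨j, rfl⟩)
    rw [he] at h1
    obtain ⟨c, hc⟩ := Submodule.mem_span_singleton.mp h1
    exact ⟨c, c.2, hc.symm⟩
  have heJ : e ∈ J := hspan e (he ▸ Submodule.mem_span_singleton_self e)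
  have he0 : e ≠ 0 := by
    rintro rfl
    obtain ⟨y, hy, hy0⟩ := Submodule.exists_mem_ne_zero_of_ne_bot hJ
    obtain ⟨c, -, hc⟩ := hJe y hy
    exact hy0 (by simpa using hc)
  refine ⟨e, heJ, he0, fun y hy z hz => ?_⟩
  obtain ⟨c, hc, rfl⟩ := hJe y hy
  have : c * e * z / e = c * z := by field_simp
  rw [this]
  exact hc z hz

end DualBasis

/-! ### Locality and the valuation property of the normalization -/

section Quadratic

/-- Every `R`-submodule of `V` containing `1` and generated by two more elements is a ring. -/
def IsQuadraticExtension (R V : Type*) [CommRing R] [CommRing V] [Algebra R V] : Prop :=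
  ∀ x z : V, ∃ a b c : R, x * z = algebraMap R V a + algebraMap R V b * x + algebraMap R V c * z

/-- Every nonzero `R`-submodule of `V` generated by two elements `y`, `z` contains an element `e`
that generates it over a ring between `R` and `V`. -/
def HasTwoGeneratedStability (R V : Type*) [CommRing R] [CommRing V] [Algebra R V] : Prop :=
  ∀ y z : V, (y ≠ 0 ∨ z ≠ 0) → ∃ (p q s r : R) (u w e : V), e ≠ 0 ∧
    e = algebraMap R V p * y + algebraMap R V q * z ∧ y = e * u ∧ z = e * w ∧
    y * y = e * (algebraMap R V s * y + algebraMap R V r * z)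

variable {R V : Type*} [CommRing R] [CommRing V] [Algebra R V]

/-- `V` is integral over `E`, so an element of `E` that is a unit of `V` is already a unit of `E`.
-/
theorem Subalgebra.mem_of_mul_eq_one [Algebra.IsIntegral R V] (E : Subalgebra R V) {x y : V}
    (hx : x ∈ E) (h : x * y = 1) : y ∈ E := by
  have : Algebra.IsIntegral E V := Algebra.IsIntegral.tower_top R
  have hu : IsUnit (⟨x, hx⟩ : E) := by
    refine isUnit_of_map_unit (algebraMap E V) _ ?_
    exact IsUnit.of_mul_eq_one y h
  obtain ⟨w, hw⟩ := hu.exists_right_inv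
  have hw' : x * (w : V) = 1 := congrArg Subtype.val hw
  have : y = w := by
    calc y = y * (x * w) := by rw [hw', mul_one]
      _ = (x * y) * w := by ring
      _ = w := by rw [h, one_mul]
  rw [this]; exact w.2

theorem Subalgebra.mem_of_mul_mem_of_isUnit [Algebra.IsIntegral R V] (E : Subalgebra R V)
    {x z : V} (hx : x ∈ E) (hu : IsUnit x) (h : x * z ∈ E) : z ∈ E := by
  obtain ⟨y, hy⟩ := hu.exists_right_inv
  have hyE := E.mem_of_mul_eq_one hx hy
  have : z = y * (x * z) := by rw [← mul_assoc, mul_comm y x, hy, one_mul]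
  rw [this]; exact E.mul_mem hyE h

theorem Module.Finite.of_forall_mem_adjoin [Algebra.IsIntegral R V] (x : V)
    (h : ∀ z, z ∈ Algebra.adjoin R {x}) : Module.Finite R V := by
  have h1 := (Algebra.IsIntegral.isIntegral (R := R) x).fg_adjoin_singleton
  rw [(Algebra.eq_top_iff.mpr h : Algebra.adjoin R {x} = ⊤)] at h1
  exact ⟨by simpa using h1⟩

theorem IsQuadraticExtension.exists_sq (h : IsQuadraticExtension R V) (x : V) :
    ∃ a b : R, x * x = algebraMap R V a * x + algebraMap R V b := by
  obtain ⟨a, b, c, h⟩ := h x x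
  exact ⟨b + c, a, by rw [h, map_add]; ring⟩

theorem algebraMap_mem_iff_mem_maximalIdeal [IsLocalRing R] [Algebra.IsIntegral R V] (n : Ideal V)
    [n.IsMaximal] {r : R} : algebraMap R V r ∈ n ↔ r ∈ IsLocalRing.maximalIdeal R := by
  rw [← IsLocalRing.eq_maximalIdeal
    (Ideal.isMaximal_comap_of_isIntegral_of_isMaximal (R := R) n), Ideal.mem_comap]

theorem HasTwoGeneratedStability.valuationRing [IsDomain V] [IsLocalRing V]
    (h2 : HasTwoGeneratedStability R V) : ValuationRing V := by
  refine ValuationRing.iff_dvd_total.mpr ⟨fun y z => ?_⟩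
  by_cases hne : y ≠ 0 ∨ z ≠ 0
  · obtain ⟨p, q, -, -, u, w, e, he0, he, hu, hw, -⟩ := h2 y z hne
    have h1 : algebraMap R V p * u + algebraMap R V q * w = 1 := by
      apply mul_left_cancel₀ he0
      conv_rhs => rw [mul_one, he, hu, hw]
      ring
    rcases IsLocalRing.isUnit_or_isUnit_of_add_one h1 with h | h
    · left
      obtain ⟨k, hk⟩ := (isUnit_of_mul_isUnit_right h).exists_right_inv
      exact ⟨k * w, by rw [hu, hw]; linear_combination (-e * w) * hk⟩
    · right
      obtain ⟨k, hk⟩ := (isUnit_of_mul_isUnit_right h).exists_right_inv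
      exact ⟨k * u, by rw [hu, hw]; linear_combination (-e * u) * hk⟩
  · push Not at hne
    left; rw [hne.1, hne.2]

variable [IsLocalRing R] [Algebra.IsIntegral R V]

open IsLocalRing

/-- If `z₀ ∉ E`, two-generated stability is applied to `1 - x` and `x + (1 - x) z₀`, which generate
the unit ideal, so `e` is a unit. Reduction modulo `n` gives `q ∉ m` and `r ∈ m`; comparing the
multiples of `z` modulo `E` gives `s ∈ m`. Then `(1 - x)² ∈ n'`, although `x ∈ n'`. -/
theorem IsQuadraticExtension.mem_of_mul_mem [IsDomain V] (h1 : IsQuadraticExtension R V)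
    (h2 : HasTwoGeneratedStability R V) (n n' : Ideal V) [n.IsMaximal] [n'.IsMaximal]
    (E : Subalgebra R V) {x z₀ : V} (hxE : x ∈ E) (hx : x ∈ n') (hx' : 1 - x ∈ n)
    (hz : x * z₀ ∈ E) : z₀ ∈ E := by
  by_contra hzE
  obtain ⟨z, hzdef⟩ : ∃ z, z = (1 - x) * z₀ := ⟨_, rfl⟩
  have hxz : x * z ∈ E := by
    have : x * z = (1 - x) * (x * z₀) := by rw [hzdef]; ring
    rw [this]; exact E.mul_mem (E.sub_mem E.one_mem hxE) hz
  have hzE' : z ∉ E := fun hz' => hzE <| by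
    have : z₀ = x * z₀ + z := by rw [hzdef]; ring
    rw [this]; exact E.add_mem hz hz'
  have hone : (x + z) + (1 - x) * (1 - z₀) = 1 := by rw [hzdef]; ring
  have hne : 1 - x ≠ 0 ∨ x + z ≠ 0 := by
    by_contra! hcon
    rw [hcon.1, hcon.2] at hone
    simp at hone
  obtain ⟨p, q, s, r, u, w, e, he0, he, hu, hw, hsq⟩ := h2 (1 - x) (x + z) hne
  have heu : IsUnit e := by
    refine IsUnit.of_mul_eq_one (w + u * (1 - z₀)) ?_
    linear_combination hone - hw - (1 - z₀) * hu
  have hem : ∀ k : Ideal V, k.IsMaximal → e ∉ k := fun k hk hek =>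
    hk.ne_top (Ideal.eq_top_of_isUnit_mem _ hek heu)
  have hxzn : x + z = 1 - (1 - x) * (1 - z₀) := by linear_combination hone
  have hq : q ∉ maximalIdeal R := by
    intro hq
    rw [← algebraMap_mem_iff_mem_maximalIdeal n] at hq
    refine hem n inferInstance ?_
    rw [he]
    exact n.add_mem (n.mul_mem_left _ hx') (n.mul_mem_right _ hq)
  have hprime : (maximalIdeal R).IsPrime := (maximalIdeal.isMaximal R).isPrime
  have hjn : algebraMap R V s * (1 - x) + algebraMap R V r * (x + z) ∈ n := by
    have : e * (algebraMap R V s * (1 - x) + algebraMap R V r * (x + z)) ∈ n := by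
      rw [← hsq]; exact n.mul_mem_left _ hx'
    exact ((‹n.IsMaximal›.isPrime).mem_or_mem this).resolve_left (hem n inferInstance)
  have hr : r ∈ maximalIdeal R := by
    rw [← algebraMap_mem_iff_mem_maximalIdeal n]
    have : algebraMap R V r = (algebraMap R V s * (1 - x) + algebraMap R V r * (x + z))
        + (algebraMap R V r * (1 - z₀) - algebraMap R V s) * (1 - x) := by
      rw [hxzn]; ring
    rw [this]
    exact n.add_mem hjn (n.mul_mem_left _ hx')
  obtain ⟨l, κ, hzz⟩ := h1.exists_sq z
  -- This is the coefficient of `z` when the relation for `(1 - x)²` is expanded modulo `E`; were it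
  -- a unit, `z` would lie in `E`.
  have hmem : p * r + q * s + q * r * l ∈ maximalIdeal R := by
    by_contra hunit
    rw [mem_maximalIdeal, mem_nonunits_iff, not_not] at hunit
    have hmemE : algebraMap R V (p * r + q * s + q * r * l) * z ∈ E := by
      have : algebraMap R V (p * r + q * s + q * r * l) * z
          = (1 - x) * (1 - x) - algebraMap R V (p * s) * ((1 - x) * (1 - x))
            - algebraMap R V (p * r + q * s) * ((1 - x) * x - x * z)
            - algebraMap R V (q * r) * (x * x + 2 * (x * z) + algebraMap R V κ) := by
        simp only [map_mul, map_add]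
        linear_combination -hsq - (algebraMap R V s * (1 - x) + algebraMap R V r * (x + z)) * he
          - algebraMap R V q * algebraMap R V r * hzz
      rw [this]
      have h1x := E.sub_mem E.one_mem hxE
      refine E.sub_mem (E.sub_mem (E.sub_mem (E.mul_mem h1x h1x) ?_) ?_) ?_
      · exact E.mul_mem (E.algebraMap_mem _) (E.mul_mem h1x h1x)
      · exact E.mul_mem (E.algebraMap_mem _) (E.sub_mem (E.mul_mem h1x hxE) hxz)
      · refine E.mul_mem (E.algebraMap_mem _) (E.add_mem (E.add_mem (E.mul_mem hxE hxE) ?_)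
          (E.algebraMap_mem _))
        rw [two_mul]; exact E.add_mem hxz hxz
    exact hzE' (E.mem_of_mul_mem_of_isUnit (E.algebraMap_mem _) (hunit.map _) hmemE)
  have hs : s ∈ maximalIdeal R := by
    have : q * s ∈ maximalIdeal R := by
      have h3 : q * s = (p * r + q * s + q * r * l) - r * (p + q * l) := by ring
      rw [h3]
      exact Ideal.sub_mem _ hmem (Ideal.mul_mem_right _ _ hr)
    exact (hprime.mem_or_mem this).resolve_left hq
  have h1x : (1 - x) * (1 - x) ∈ n' := by
    rw [hsq]
    rw [← algebraMap_mem_iff_mem_maximalIdeal n'] at hs hr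
    exact n'.mul_mem_left _ (n'.add_mem (n'.mul_mem_right _ hs) (n'.mul_mem_right _ hr))
  have h1x' : 1 - x ∈ n' := (‹n'.IsMaximal›.isPrime.mem_or_mem h1x).elim id id
  refine ‹n'.IsMaximal›.ne_top ((Ideal.eq_top_iff_one _).mpr ?_)
  have : (1 : V) = (1 - x) + x := by ring
  rw [this]; exact n'.add_mem h1x' hx

theorem IsQuadraticExtension.isLocalRing [IsDomain V] (h1 : IsQuadraticExtension R V)
    (h2 : HasTwoGeneratedStability R V) (hfin : ¬ Module.Finite R V) : IsLocalRing V := by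
  refine IsLocalRing.of_isUnit_or_isUnit_one_sub_self fun x => ?_
  by_contra! hx
  obtain ⟨n', hn', hxn'⟩ := exists_max_ideal_of_mem_nonunits hx.1
  obtain ⟨n, hn, hxn⟩ := exists_max_ideal_of_mem_nonunits hx.2
  refine hfin (Module.Finite.of_forall_mem_adjoin x fun z => ?_)
  set E := Algebra.adjoin R {x} with hE
  have hxE : x ∈ E := Algebra.self_mem_adjoin_singleton R x
  obtain ⟨α, β, γ, hxz⟩ := h1 x z
  have hmul : (x - algebraMap R V γ) * z ∈ E := by
    have : (x - algebraMap R V γ) * z = algebraMap R V α + algebraMap R V β * x := by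
      rw [sub_mul, hxz]; ring
    rw [this]
    exact E.add_mem (E.algebraMap_mem _) (E.mul_mem (E.algebraMap_mem _) hxE)
  -- Modulo `m`, the quadratic equation of `x` has the roots `0` (at `n'`) and `1` (at `n`). If `γ`
  -- is neither, then `x - γ` is a unit, since otherwise `γ` would be a third root.
  by_cases hγ : γ ∈ maximalIdeal R
  · refine h1.mem_of_mul_mem h2 n n' E (x := x - algebraMap R V γ)
      (E.sub_mem hxE (E.algebraMap_mem _)) ?_ ?_ hmul
    · exact n'.sub_mem hxn' ((algebraMap_mem_iff_mem_maximalIdeal n').mpr hγ)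
    · rw [sub_sub_eq_add_sub, add_sub_right_comm]
      exact n.add_mem hxn ((algebraMap_mem_iff_mem_maximalIdeal n).mpr hγ)
  by_cases hγ' : 1 - γ ∈ maximalIdeal R
  · refine h1.mem_of_mul_mem h2 n' n E (x := algebraMap R V γ - x)
      (E.sub_mem (E.algebraMap_mem _) hxE) ?_ ?_ ?_
    · have := n.sub_mem hxn ((algebraMap_mem_iff_mem_maximalIdeal n).mpr hγ')
      rw [map_sub, map_one] at this
      convert this using 1; ring
    · have := n'.add_mem hxn' ((algebraMap_mem_iff_mem_maximalIdeal n').mpr hγ')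
      rw [map_sub, map_one] at this
      convert this using 1; ring
    · rw [← neg_sub, neg_mul]; exact E.neg_mem hmul
  refine E.mem_of_mul_mem_of_isUnit (E.sub_mem hxE (E.algebraMap_mem _)) ?_ hmul
  by_contra hnu
  obtain ⟨k, hk, hxk⟩ := exists_max_ideal_of_mem_nonunits hnu
  obtain ⟨a, b, hab⟩ := h1.exists_sq x
  have hb : b ∈ maximalIdeal R := by
    rw [← algebraMap_mem_iff_mem_maximalIdeal n']
    have : algebraMap R V b = (x - algebraMap R V a) * x := by rw [sub_mul, hab]; ring
    rw [this]; exact n'.mul_mem_left _ hxn'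
  have hab' : 1 - a - b ∈ maximalIdeal R := by
    rw [← algebraMap_mem_iff_mem_maximalIdeal n]
    have : algebraMap R V (1 - a - b) = (1 + x - algebraMap R V a) * (1 - x) := by
      have : algebraMap R V b = x * x - algebraMap R V a * x := by rw [hab]; ring
      simp only [map_sub, map_one]
      rw [this]; ring
    rw [this]; exact n.mul_mem_left _ hxn
  have hk' : γ * γ - a * γ - b ∈ maximalIdeal R := by
    rw [← algebraMap_mem_iff_mem_maximalIdeal k]
    have : algebraMap R V (γ * γ - a * γ - b)
        = (algebraMap R V a - x - algebraMap R V γ) * (x - algebraMap R V γ) := by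
      have : algebraMap R V b = x * x - algebraMap R V a * x := by rw [hab]; ring
      simp only [map_sub, map_mul]
      rw [this]; ring
    rw [this]; exact k.mul_mem_left _ hxk
  have hγγ : γ * (1 - γ) ∈ maximalIdeal R := by
    have : γ * (1 - γ) = -(γ * γ - a * γ - b) + γ * (1 - a - b) + (γ - 1) * b := by ring
    rw [this]
    exact Ideal.add_mem _ (Ideal.add_mem _ (neg_mem hk') (Ideal.mul_mem_left _ _ hab'))
      (Ideal.mul_mem_left _ _ hb)
  exact ((maximalIdeal.isMaximal R).isPrime.mem_or_mem hγγ).elim hγ hγ'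

end Quadratic

/-! ### Consequences of stability inside the normalization -/

section StableNormalization

theorem Subalgebra.inv_mem_of_isIntegral {R F : Type*} [CommRing R] [Field F] [Algebra R F]
    (E : Subalgebra R F) {x : F} (hx : x ∈ E) (hxi : IsIntegral R x) (hi : IsIntegral R x⁻¹) :
    x⁻¹ ∈ E := by
  by_cases h0 : x = 0
  · rw [h0, inv_zero]; exact E.zero_mem
  exact (E.comap (integralClosure R F).val).mem_of_mul_eq_one (x := ⟨x, hxi⟩) (y := ⟨x⁻¹, hi⟩) hx
    (Subtype.ext (mul_inv_cancel₀ h0))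

theorem IsFractionRing.integralClosure_self {R F : Type*} [CommRing R] [Field F]
    [Algebra R F] [IsFractionRing R F] : IsFractionRing (integralClosure R F) F :=
  IsFractionRing.of_field _ F fun z => by
    obtain ⟨a, b, hb, rfl⟩ := IsFractionRing.div_surjective (A := R) z
    exact ⟨algebraMap R _ a, algebraMap R _ b, rfl⟩

section

variable {R : Type u} {F : Type v} [CommRing R] [Field F]
  [Algebra R F] [IsFractionRing R F]

open IsLocalRing

/-- In a local ring of dimension at most one with quadratic local normalization `V`, every nonunit
of `V` has a power divisible by any given nonzero element of `V`. -/
theorem exists_dvd_pow_of_quadratic [IsLocalRing R] [IsLocalRing (integralClosure R F)]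
    [ValuationRing (integralClosure R F)] (hq : IsQuadraticExtension R (integralClosure R F))
    (hdim : ∀ r : R, r ≠ 0 → maximalIdeal R ≤ (Ideal.span {r}).radical)
    {w y : integralClosure R F} (hw : w ≠ 0) (hy : ¬ IsUnit y) : ∃ n, w ∣ y ^ n := by
  have hmax : ∀ r : R, algebraMap R (integralClosure R F) r
      ∈ maximalIdeal (integralClosure R F) ↔ r ∈ maximalIdeal R := fun r =>
    algebraMap_mem_iff_mem_maximalIdeal _
  obtain ⟨r, hr, hwr⟩ : ∃ r : R, r ≠ 0 ∧ w ∣ algebraMap R _ r := by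
    obtain ⟨a, b, hb, hab⟩ := IsFractionRing.div_surjective (A := R) (w : F)
    have hb0 : algebraMap R F b ≠ 0 :=
      IsFractionRing.to_map_ne_zero_of_mem_nonZeroDivisors hb
    rw [div_eq_iff hb0] at hab
    refine ⟨a, ?_, algebraMap R _ b, Subtype.ext hab⟩
    rintro rfl
    rw [map_zero, eq_comm, mul_eq_zero] at hab
    exact hab.elim (fun h => hw (Subtype.ext h)) hb0
  obtain ⟨s, hs, hsy⟩ : ∃ s ∈ maximalIdeal R, algebraMap R (integralClosure R F) s ∣ y * y := by
    obtain ⟨a, b, hab⟩ := hq.exists_sq y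
    have hyM : y ∈ maximalIdeal (integralClosure R F) := hy
    have hb : b ∈ maximalIdeal R := by
      rw [← hmax]
      have : algebraMap R (integralClosure R F) b = (y - algebraMap R _ a) * y := by
        rw [sub_mul, hab]; ring
      rw [this]; exact Ideal.mul_mem_left _ _ hyM
    by_cases ha : a ∈ maximalIdeal R
    · rcases ValuationRing.dvd_total (algebraMap R (integralClosure R F) a)
        (algebraMap R (integralClosure R F) b) with h | h
      · exact ⟨a, ha, by rw [hab]; exact dvd_add (dvd_mul_right _ _) h⟩
      · exact ⟨b, hb, by rw [hab]; exact dvd_add (h.mul_right _) dvd_rfl⟩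
    · have hu : IsUnit (y - algebraMap R _ a) := by
        by_contra hnu
        have hnu : y - algebraMap R _ a ∈ maximalIdeal (integralClosure R F) := hnu
        refine ha ((hmax a).mp ?_)
        have := Ideal.sub_mem _ hyM hnu
        rwa [sub_sub_cancel] at this
      refine ⟨b, hb, Dvd.dvd.mul_right ?_ _⟩
      have : algebraMap R (integralClosure R F) b = (y - algebraMap R _ a) * y := by
        rw [sub_mul, hab]; ring
      rw [this]
      exact hu.mul_left_dvd.mpr dvd_rfl
  obtain ⟨n, hn⟩ := hdim r hr hs
  obtain ⟨k, hk⟩ := Ideal.mem_span_singleton.mp hn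
  refine ⟨2 * n, hwr.trans ((Dvd.intro (algebraMap R _ k) ?_).trans (?_ :
    algebraMap R (integralClosure R F) (s ^ n) ∣ _))⟩
  · rw [← map_mul, hk]
  · rw [map_pow, pow_mul, sq]
    exact pow_dvd_pow_of_dvd hsy n

/-- If `e` is not integral, `e⁻¹` is a nonunit of `V`, and a nonzero `a ∈ I` divides some `e⁻ⁿ` in
`V`. Then `e = (eⁿ⁺¹ a)(e⁻ⁿ / a)` is a product of an element of `I` and one of `V`, hence integral
after all. No finite generation of `I` is needed. -/
theorem isIntegral_of_mem_multiplierRing_ideal [ValuationRing (integralClosure R F)]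
    (hV : ∀ {w y : integralClosure R F}, w ≠ 0 → ¬ IsUnit y → ∃ n, w ∣ y ^ n)
    {I : Ideal R} (hI : I ≠ ⊥) {e : F}
    (he : e ∈ multiplierRing (Submodule.map (Algebra.linearMap R F) I)) : IsIntegral R e := by
  have := IsFractionRing.integralClosure_self (R := R) (F := F)
  by_contra hnot
  rcases ValuationRing.isInteger_or_isInteger (integralClosure R F) e with ⟨w, hw⟩ | ⟨f, hf⟩
  · exact hnot (hw ▸ w.2)
  have hf : (f : F) = e⁻¹ := hf
  have he0 : e ≠ 0 := by
    rintro rfl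
    exact hnot isIntegral_zero
  have hfu : ¬ IsUnit f := by
    intro hu
    obtain ⟨g, hg⟩ := hu.exists_right_inv
    apply hnot
    have : e = g := by
      have h1 : (f : F) * g = 1 := congrArg Subtype.val hg
      rw [hf] at h1
      rw [← mul_one e, ← h1, mul_inv_cancel_left₀ he0]
    rw [this]; exact g.2
  obtain ⟨a, haI, ha⟩ := Submodule.exists_mem_ne_zero_of_ne_bot hI
  obtain ⟨n, w, hw⟩ := hV (w := algebraMap R _ a) (by
    intro h
    exact ha (IsFractionRing.injective R F (by rw [map_zero]; exact congrArg Subtype.val h))) hfu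
  have hpow : ∀ n, e ^ n * algebraMap R F a ∈ Submodule.map (Algebra.linearMap R F) I := fun n =>
    (pow_mem he n : e ^ n ∈ multiplierRing _) _ ⟨a, haI, rfl⟩
  obtain ⟨b, -, hb⟩ := hpow (n + 1)
  have hw' : e⁻¹ ^ n = algebraMap R F a * w := by
    rw [← hf]; exact congrArg Subtype.val hw
  have : e = algebraMap R F b * w := by
    have hb : algebraMap R F b = e ^ (n + 1) * algebraMap R F a := hb
    rw [hb, mul_assoc, ← hw', inv_pow, pow_succ']
    field_simp
  rw [this] at hnot
  exact hnot (IsIntegral.mul isIntegral_algebraMap w.2)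

end

variable {R : Type u} {F : Type v} [CommRing R] [IsDomain R] [IsLocalRing R] [Field F]
  [Algebra R F] [IsFractionRing R F]

open IsLocalRing

/-- Write `J = eE`. From `1 ∈ J` comes `e⁻¹ ∈ E`, and integrality of `e` makes it a unit of `E`; so
`J = E` is a ring. -/
theorem IsStableRing.mul_mem_of_fg (hR : IsStableRing R) {J : Submodule R F} (hfg : J.FG)
    (h1 : 1 ∈ J) (hJ : ∀ y ∈ J, IsIntegral R y) {y z : F} (hy : y ∈ J) (hz : z ∈ J) :
    y * z ∈ J := by
  have hJ0 : J ≠ ⊥ := by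
    rintro rfl
    exact one_ne_zero ((Submodule.mem_bot R).mp h1)
  obtain ⟨e, he, he0, hmul⟩ := hR.exists_generator_of_fg hJ0 hfg
  have hinv : e⁻¹ ∈ multiplierRing J := fun z hz => by
    have := hmul 1 h1 z hz
    rwa [one_mul, div_eq_inv_mul] at this
  have hmem : e ∈ multiplierRing J := by
    have := (multiplierRing J).inv_mem_of_isIntegral hinv
      (isIntegral_of_mem_multiplierRing hJ0 hfg hinv) (by rw [inv_inv]; exact hJ e he)
    rwa [inv_inv] at this
  have := hmem _ (hmul y hy z hz)
  rwa [mul_div_cancel₀ _ he0] at this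

theorem IsStableRing.isQuadraticExtension (hR : IsStableRing R) :
    IsQuadraticExtension R (integralClosure R F) := by
  intro x z
  have hmem : (x : F) * z ∈ Submodule.span R {(1 : F), (x : F), (z : F)} := by
    refine hR.mul_mem_of_fg (Submodule.fg_span (Set.toFinite _)) (Submodule.subset_span (by simp))
      ?_ (Submodule.subset_span (by simp)) (Submodule.subset_span (by simp))
    have : Submodule.span R {(1 : F), (x : F), (z : F)}
        ≤ Subalgebra.toSubmodule (integralClosure R F) := by
      rw [Submodule.span_le]
      rintro y (rfl | rfl | rfl)
      · exact (integralClosure R F).one_mem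
      · exact x.2
      · exact z.2
    exact fun y hy => this hy
  obtain ⟨a, b, c, h⟩ := Submodule.mem_span_triple.mp hmem
  refine ⟨a, b, c, Subtype.ext ?_⟩
  simp only [Algebra.smul_def, mul_one] at h
  exact h.symm

theorem IsStableRing.hasTwoGeneratedStability (hR : IsStableRing R) :
    HasTwoGeneratedStability R (integralClosure R F) := by
  intro y z hyz
  set J := Submodule.span R {(y : F), (z : F)} with hJ
  have hy : (y : F) ∈ J := Submodule.subset_span (by simp)
  have hz : (z : F) ∈ J := Submodule.subset_span (by simp)
  have hJ0 : J ≠ ⊥ := by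
    intro h
    rw [h, Submodule.mem_bot] at hy hz
    rcases hyz with h | h
    · exact h (Subtype.ext hy)
    · exact h (Subtype.ext hz)
  have hfg : J.FG := Submodule.fg_span (Set.toFinite _)
  obtain ⟨e, he, he0, hmul⟩ := hR.exists_generator_of_fg hJ0 hfg
  have hint : ∀ y ∈ J, IsIntegral R (y / e) := fun y hy =>
    isIntegral_of_mem_multiplierRing hJ0 hfg fun z hz => by
      rw [div_mul_eq_mul_div]; exact hmul y hy z hz
  obtain ⟨p, q, hpq⟩ := Submodule.mem_span_pair.mp he
  obtain ⟨s, r, hsr⟩ := Submodule.mem_span_pair.mp (hmul y hy y hy)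
  simp only [Algebra.smul_def] at hpq hsr
  refine ⟨p, q, s, r, ⟨y / e, hint y hy⟩, ⟨z / e, hint z hz⟩,
    algebraMap R _ p * y + algebraMap R _ q * z, ?_, rfl, ?_, ?_, ?_⟩
  · intro h
    exact he0 (by rw [← hpq]; exact congrArg Subtype.val h)
  · refine Subtype.ext ?_
    change (y : F) = (algebraMap R F p * y + algebraMap R F q * z) * (y / e)
    rw [hpq, mul_div_cancel₀ _ he0]
  · refine Subtype.ext ?_
    change (z : F) = (algebraMap R F p * y + algebraMap R F q * z) * (z / e)
    rw [hpq, mul_div_cancel₀ _ he0]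
  · refine Subtype.ext ?_
    change (y : F) * y = (algebraMap R F p * y + algebraMap R F q * z)
      * (algebraMap R F s * y + algebraMap R F r * z)
    rw [hpq, hsr, mul_div_cancel₀ _ he0]

theorem IsStableRing.exists_dvd [IsLocalRing (integralClosure R F)]
    [ValuationRing (integralClosure R F)]
    (hV : ∀ {w y : integralClosure R F}, w ≠ 0 → ¬ IsUnit y → ∃ n, w ∣ y ^ n)
    (hR : IsStableRing R) {I : Ideal R} (hI : I ≠ ⊥) :
    ∃ c ∈ I, (∀ y ∈ I, algebraMap R (integralClosure R F) c ∣ algebraMap R _ y) ∧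
      ∀ y ∈ I, ∀ z ∈ I, ∃ f ∈ I, y * z = c * f := by
  obtain ⟨n, x, q, hx, hxq, hq⟩ := (hR I hI).hasStableDualBasis (F := F) hI
  set J := Submodule.map (Algebra.linearMap R F) I with hJ
  have hE : ∀ j, ∀ y ∈ J, q j * y ∈ multiplierRing J := fun j y hy z hz => hq j y hy z hz
  have hint : ∀ e ∈ multiplierRing J, IsIntegral R e := fun e he =>
    isIntegral_of_mem_multiplierRing_ideal hV hI he
  have hunit : IsUnit (∑ j, (⟨q j * x j, hint _ (hE j _ (hx j))⟩ : integralClosure R F)) := by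
    convert isUnit_one
    refine Subtype.ext ?_
    rw [AddSubmonoidClass.coe_finsetSum]
    exact hxq
  -- The sum `∑ q_j x_j = 1` has a unit summand because `V` is local; the corresponding `x_j`
  -- generates `I` over its multiplier ring.
  obtain ⟨j, -, hj⟩ := IsLocalRing.exists_of_isUnit_sum hunit
  obtain ⟨g, hg⟩ := hj.exists_right_inv
  have hg : q j * x j * g = 1 := congrArg Subtype.val hg
  have hginv : (g : F) = (q j * x j)⁻¹ := eq_inv_of_mul_eq_one_right hg
  have hgE : (g : F) ∈ multiplierRing J := by
    rw [hginv]
    refine (multiplierRing J).inv_mem_of_isIntegral (hE j _ (hx j)) (hint _ (hE j _ (hx j))) ?_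
    rw [← hginv]; exact g.2
  obtain ⟨c, hcI, hc⟩ := hx j
  have hc : algebraMap R F c = x j := hc
  refine ⟨c, hcI, fun y hy => ⟨⟨q j * algebraMap R F y, hint _ (hE j _ ⟨y, hy, rfl⟩)⟩ * g,
    Subtype.ext ?_⟩, fun y hy z hz => ?_⟩
  · change algebraMap R F y = algebraMap R F c * (q j * algebraMap R F y * g)
    rw [hc]; linear_combination (-algebraMap R F y) * hg
  · obtain ⟨f, hf, hfe⟩ := hgE _ (hE j _ ⟨y, hy, rfl⟩ _ ⟨z, hz, rfl⟩)
    refine ⟨f, hf, IsFractionRing.injective R F ?_⟩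
    have hfe : algebraMap R F f = g * (q j * algebraMap R F y * algebraMap R F z) := hfe
    rw [map_mul, map_mul, hfe, hc]
    linear_combination (-algebraMap R F y * algebraMap R F z) * hg

/-- Any `b ∈ I` of least value can serve as generator: it differs from the `c` of `exists_dvd` by a
unit of the multiplier ring. -/
theorem IsStableRing.exists_mul_eq_mul [IsLocalRing (integralClosure R F)]
    [ValuationRing (integralClosure R F)]
    (hV : ∀ {w y : integralClosure R F}, w ≠ 0 → ¬ IsUnit y → ∃ n, w ∣ y ^ n)
    (hR : IsStableRing R) {I : Ideal R} (hI : I ≠ ⊥) {b : R} (hb : b ∈ I)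
    (hdvd : ∀ y ∈ I, algebraMap R (integralClosure R F) b ∣ algebraMap R _ y) :
    ∀ y ∈ I, ∀ z ∈ I, ∃ f ∈ I, y * z = b * f := by
  obtain ⟨c, hc, hcd, hmul⟩ := hR.exists_dvd hV hI
  set J := Submodule.map (Algebra.linearMap R F) I with hJ
  have hb0 : b ≠ 0 := by
    rintro rfl
    refine hI ((Submodule.eq_bot_iff _).mpr fun y hy => ?_)
    have := hdvd y hy
    rw [map_zero, zero_dvd_iff] at this
    exact IsFractionRing.injective R F (by rw [map_zero]; exact congrArg Subtype.val this)
  have hc0 : c ≠ 0 := by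
    rintro rfl
    obtain ⟨f, -, h⟩ := hmul b hb b hb
    rw [zero_mul] at h
    exact hb0 (mul_self_eq_zero.mp h)
  have hinj := IsFractionRing.injective R F
  have hb0' : algebraMap R F b ≠ 0 := (map_ne_zero_iff _ hinj).mpr hb0
  have hc0' : algebraMap R F c ≠ 0 := (map_ne_zero_iff _ hinj).mpr hc0
  have hE : algebraMap R F b / algebraMap R F c ∈ multiplierRing J := by
    rintro _ ⟨y, hy, rfl⟩
    obtain ⟨f, hf, h⟩ := hmul b hb y hy
    refine ⟨f, hf, ?_⟩
    have h := congrArg (algebraMap R F) h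
    rw [map_mul, map_mul] at h
    change algebraMap R F f = algebraMap R F b / algebraMap R F c * algebraMap R F y
    rw [div_mul_eq_mul_div, h, mul_div_cancel_left₀ _ hc0']
  have hE' : algebraMap R F c / algebraMap R F b ∈ multiplierRing J := by
    rw [← inv_div]
    refine (multiplierRing J).inv_mem_of_isIntegral hE
      (isIntegral_of_mem_multiplierRing_ideal hV hI hE) ?_
    obtain ⟨k, hk⟩ := hdvd c hc
    have hk : algebraMap R F c = algebraMap R F b * k := congrArg Subtype.val hk
    rw [inv_div, hk, mul_div_cancel_left₀ _ hb0']
    exact k.2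
  intro y hy z hz
  obtain ⟨f, hf, h⟩ := hmul y hy z hz
  obtain ⟨g, hg, hge⟩ := hE' _ ⟨f, hf, rfl⟩
  refine ⟨g, hg, hinj ?_⟩
  have hge : algebraMap R F g = algebraMap R F c / algebraMap R F b * algebraMap R F f := hge
  rw [h, map_mul, map_mul, hge]
  field_simp

end StableNormalization

/-- The normalization of `R` is a discrete valuation ring `V` such that `V / R` is divisible and
annihilators in `V / R` of elements of `R` only depend on valuations. -/
structure HasDivisibleValuativeNormalization (R F : Type*) [CommRing R] [Field F]
    [Algebra R F] : Prop where
  isDiscreteValuationRing : IsDiscreteValuationRing (integralClosure R F)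
  exists_eq_add_mul : ∀ r : R, r ≠ 0 → ∀ y : integralClosure R F,
    ∃ (s : R) (z : integralClosure R F), y = algebraMap R _ s + algebraMap R _ r * z
  exists_mul_eq : ∀ (b c : R) (w y : integralClosure R F), algebraMap R _ c = algebraMap R _ b * w →
    ∀ p : R, algebraMap R _ b * y = algebraMap R _ p →
      ∃ s : R, algebraMap R (integralClosure R F) c * y = algebraMap R _ s

/-! ### Residue field and uniformizer of a non-finite quadratic extension -/

section Quadratic

open IsLocalRing

theorem isUnit_sub_of_mem_maximalIdeal {V : Type*} [CommRing V] [IsLocalRing V] {y z : V}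
    (hy : y ∈ maximalIdeal V) (hz : IsUnit z) : IsUnit (y - z) := by
  by_contra h
  have h : y - z ∈ maximalIdeal V := h
  have := Ideal.sub_mem _ hy h
  rw [sub_sub_cancel] at this
  exact this hz

variable {R V : Type*} [CommRing R] [CommRing V] [Algebra R V] [Algebra.IsIntegral R V]
  [IsLocalRing V]

/-- If every `y - r` were a unit, the relation `(y - γ) z ∈ R[y]` would put every `z` into `R[y]`.
-/
theorem IsQuadraticExtension.exists_sub_mem (h1 : IsQuadraticExtension R V)
    (hfin : ¬ Module.Finite R V) (y : V) : ∃ r : R, y - algebraMap R V r ∈ maximalIdeal V := by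
  by_contra! hy
  refine hfin (Module.Finite.of_forall_mem_adjoin y fun z => ?_)
  set E := Algebra.adjoin R {y}
  have hyE : y ∈ E := Algebra.self_mem_adjoin_singleton R y
  obtain ⟨α, β, γ, h⟩ := h1 y z
  refine E.mem_of_mul_mem_of_isUnit (E.sub_mem hyE (E.algebraMap_mem γ)) ?_ ?_
  · have := hy γ
    rwa [mem_maximalIdeal, mem_nonunits_iff, not_not] at this
  · have : (y - algebraMap R V γ) * z = algebraMap R V α + algebraMap R V β * y := by
      rw [sub_mul, h]; ring
    rw [this]
    exact E.add_mem (E.algebraMap_mem _) (E.mul_mem (E.algebraMap_mem _) hyE)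

theorem algebraMap_mem_maximalIdeal [IsLocalRing R] {r : R} :
    algebraMap R V r ∈ maximalIdeal V ↔ r ∈ maximalIdeal R :=
  algebraMap_mem_iff_mem_maximalIdeal _

/-- A square of a nonunit is divisible by `c` if `c` divides all nonunits of `R`. -/
theorem IsQuadraticExtension.dvd_sq [IsLocalRing R] (h1 : IsQuadraticExtension R V) {c : R}
    (hc : ∀ a ∈ maximalIdeal R, algebraMap R V c ∣ algebraMap R V a) {y : V}
    (hy : y ∈ maximalIdeal V) :
    algebraMap R V c ∣ y ∨ ∃ a ∈ maximalIdeal R, ∃ b ∈ maximalIdeal R,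
      y * y = algebraMap R V a * y + algebraMap R V b := by
  obtain ⟨a, b, hab⟩ := h1.exists_sq y
  have hb' : algebraMap R V b = (y - algebraMap R V a) * y := by rw [sub_mul, hab]; ring
  have hb : b ∈ maximalIdeal R := by
    rw [← algebraMap_mem_maximalIdeal (V := V), hb']
    exact Ideal.mul_mem_left _ _ hy
  by_cases ha : a ∈ maximalIdeal R
  · exact Or.inr ⟨a, ha, b, hb, hab⟩
  · left
    rw [mem_maximalIdeal, mem_nonunits_iff, not_not] at ha
    have hu := isUnit_sub_of_mem_maximalIdeal hy (ha.map (algebraMap R V))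
    refine (hc b hb).trans ?_
    rw [hb']
    exact hu.mul_left_dvd.mpr dvd_rfl

/-- If `c ∤ y`, then `y` is a uniformizer and `c` is associated to `y²`. In `y² = a y + b` the
element `b` is then also associated to `y²`. Stability of `m` gives `bV ⊆ R[y]`, so `V = R + yR + bV
= R[y]` is finite. -/
theorem IsQuadraticExtension.dvd_of_mem_maximalIdeal [IsLocalRing R] [IsDomain V] [FaithfulSMul R V]
    [ValuationRing V] (h1 : IsQuadraticExtension R V)
    (hfin : ¬ Module.Finite R V) {c : R} (hc0 : c ≠ 0)
    (hc : ∀ a ∈ maximalIdeal R, algebraMap R V c ∣ algebraMap R V a)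
    (hmul : ∀ b ∈ maximalIdeal R, (∀ a ∈ maximalIdeal R, algebraMap R V b ∣ algebraMap R V a) →
      ∀ y ∈ maximalIdeal R, ∀ z ∈ maximalIdeal R, ∃ f ∈ maximalIdeal R, y * z = b * f)
    {y : V} (hy : y ∈ maximalIdeal V) : algebraMap R V c ∣ y := by
  by_contra hcy
  have hinj := FaithfulSMul.algebraMap_injective R V
  have hc0' : algebraMap R V c ≠ 0 := (map_ne_zero_iff _ hinj).mpr hc0
  have hsq : ∀ w ∈ maximalIdeal V, algebraMap R V c ∣ w * w := by
    intro w hw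
    rcases h1.dvd_sq hc hw with h | ⟨a, ha, b, hb, hab⟩
    · exact h.mul_right _
    · rw [hab]; exact dvd_add ((hc a ha).mul_right _) (hc b hb)
  have hassoc : ∀ w ∈ maximalIdeal V, ¬ algebraMap R V c ∣ w → w * w ∣ algebraMap R V c := by
    intro w hw hcw
    obtain ⟨u, hu⟩ := (ValuationRing.dvd_total (algebraMap R V c) w).resolve_left hcw
    have hum : u ∈ maximalIdeal V := by
      intro huu
      exact hcw (by rw [hu]; exact huu.mul_right_dvd.mpr dvd_rfl)
    obtain ⟨k, hk⟩ := hsq u hum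
    refine ⟨k, mul_left_cancel₀ hc0' ?_⟩
    calc algebraMap R V c * algebraMap R V c = (w * w) * (u * u) := by rw [hu]; ring
      _ = _ := by rw [hk]; ring
  have hyM : ∀ w ∈ maximalIdeal V, y ∣ w := by
    intro w hw
    rcases ValuationRing.dvd_total y w with h | ⟨h, hwh⟩
    · exact h
    have hcw : ¬ algebraMap R V c ∣ w := fun h' => hcy (by rw [hwh]; exact h'.mul_right _)
    have hw0 : w ≠ 0 := by rintro rfl; exact hcw (dvd_zero _)
    obtain ⟨k', hk'⟩ := hassoc y hy hcy
    obtain ⟨l', hl'⟩ := hsq w hw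
    have : h * (h * (k' * l')) = 1 := by
      apply mul_left_cancel₀ (mul_ne_zero hw0 hw0)
      calc w * w * (h * (h * (k' * l'))) = ((w * h) * (w * h) * k') * l' := by ring
        _ = w * w * 1 := by rw [← hwh, ← hk', ← hl', mul_one]
    have hu : IsUnit h := IsUnit.of_mul_eq_one _ this
    rw [hwh]; exact hu.mul_right_dvd.mpr dvd_rfl
  obtain ⟨a, ha, b, hb, hab⟩ := (h1.dvd_sq hc hy).resolve_left hcy
  obtain ⟨v, hv, hbv⟩ : ∃ v, IsUnit v ∧ algebraMap R V b = y * y * v := by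
    obtain ⟨u, hu⟩ := (ValuationRing.dvd_total (algebraMap R V c) y).resolve_left hcy
    have hum : u ∈ maximalIdeal V := by
      intro huu
      exact hcy (by rw [hu]; exact huu.mul_right_dvd.mpr dvd_rfl)
    obtain ⟨k, hk⟩ := hc a ha
    refine ⟨1 - u * k, ?_, ?_⟩
    · exact (IsLocalRing.isUnit_or_isUnit_one_sub_self (u * k)).resolve_left
        fun h => hum (isUnit_of_mul_isUnit_left h)
    · have : algebraMap R V a = y * u * k := by rw [hk, hu]
      rw [mul_sub, mul_one, eq_sub_iff_add_eq]
      conv_rhs => rw [hab, this]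
      ring
  have hbc : ∀ a ∈ maximalIdeal R, algebraMap R V b ∣ algebraMap R V a := by
    intro a ha
    refine Dvd.dvd.trans ?_ (hc a ha)
    rw [hbv]
    exact hv.mul_right_dvd.mpr (hassoc y hy hcy)
  set E := Algebra.adjoin R {y} with hE
  have hyE : y ∈ E := Algebra.self_mem_adjoin_singleton R y
  have hbE : ∀ w : V, algebraMap R V b * w ∈ E := by
    intro w
    obtain ⟨α, β, γ, h⟩ := h1 y w
    have hmem : (y - algebraMap R V γ) * w ∈ E := by
      have : (y - algebraMap R V γ) * w = algebraMap R V α + algebraMap R V β * y := by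
        rw [sub_mul, h]; ring
      rw [this]
      exact E.add_mem (E.algebraMap_mem _) (E.mul_mem (E.algebraMap_mem _) hyE)
    by_cases hγ : γ ∈ maximalIdeal R
    -- The choice of `γ - a` comes from `(y + γ - a)(y - γ) = b - γ(γ - a)`, which becomes `b(1 -
    -- μ)` with `1 - μ` a unit.
    · obtain ⟨μ, hμ, hγμ⟩ := hmul b hb hbc γ hγ (γ - a) (Ideal.sub_mem _ hγ ha)
      have hunit : IsUnit (1 - μ) :=
        (IsLocalRing.isUnit_or_isUnit_one_sub_self μ).resolve_left hμ
      refine E.mem_of_mul_mem_of_isUnit (E.algebraMap_mem (1 - μ)) (hunit.map _) ?_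
      have h3 := congrArg (algebraMap R V) hγμ
      simp only [map_mul, map_sub] at h3
      have : algebraMap R V (1 - μ) * (algebraMap R V b * w)
          = (y + algebraMap R V γ - algebraMap R V a) * ((y - algebraMap R V γ) * w) := by
        simp only [map_sub, map_one]
        linear_combination (-w) * hab + w * h3
      rw [this]
      exact E.mul_mem (E.sub_mem (E.add_mem hyE (E.algebraMap_mem _)) (E.algebraMap_mem _)) hmem
    · rw [mem_maximalIdeal, mem_nonunits_iff, not_not] at hγ
      refine E.mul_mem (E.algebraMap_mem _) (E.mem_of_mul_mem_of_isUnit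
        (E.sub_mem hyE (E.algebraMap_mem γ)) ?_ hmem)
      exact isUnit_sub_of_mem_maximalIdeal hy (hγ.map _)
  refine hfin (Module.Finite.of_forall_mem_adjoin y fun z => ?_)
  have hdiv : ∀ z : V, ∃ (r : R) (w : V), z = algebraMap R V r + y * w := by
    intro z
    obtain ⟨r, hr⟩ := h1.exists_sub_mem hfin z
    obtain ⟨w, hw⟩ := hyM _ hr
    exact ⟨r, w, by rw [← hw]; ring⟩
  obtain ⟨r, w, hw⟩ := hdiv z
  obtain ⟨r', w', hw'⟩ := hdiv w
  obtain ⟨v', hv'⟩ := hv.exists_right_inv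
  have : z = algebraMap R V r + y * algebraMap R V r' + algebraMap R V b * (v' * w') := by
    rw [hw, hw', hbv]; linear_combination (-y * y * w') * hv'
  rw [this]
  exact E.add_mem (E.add_mem (E.algebraMap_mem _) (E.mul_mem hyE (E.algebraMap_mem _))) (hbE _)

/-- A local domain whose maximal ideal is generated by an element `c` with the property that every
nonzero element divides a power of `c` is a discrete valuation ring. -/
theorem isDiscreteValuationRing_of_forall_dvd {V : Type*} [CommRing V] [IsDomain V]
    [IsLocalRing V] {c : V} (hc : c ∈ maximalIdeal V) (hc0 : c ≠ 0)
    (hdvd : ∀ y ∈ maximalIdeal V, c ∣ y) (hpow : ∀ w : V, w ≠ 0 → ∃ n, w ∣ c ^ n) :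
    IsDiscreteValuationRing V := by
  classical
  refine IsDiscreteValuationRing.ofHasUnitMulPowIrreducibleFactorization ⟨c, ?_, ?_⟩
  · refine IsDiscreteValuationRing.irreducible_of_span_eq_maximalIdeal c hc0 (le_antisymm ?_ ?_)
    · exact fun y hy => Ideal.mem_span_singleton.mpr (hdvd y hy)
    · exact (Ideal.span_singleton_le_iff_mem _).mpr hc
  · intro x hx
    have hex := hpow x hx
    refine ⟨Nat.find hex, ?_⟩
    obtain ⟨s, hs⟩ := Nat.find_spec hex
    have hsu : IsUnit s := by
      by_contra hsu
      obtain ⟨s', rfl⟩ := hdvd s hsu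
      rcases hn : Nat.find hex with _ | k
      · rw [hn, pow_zero] at hs
        exact hsu (IsUnit.of_mul_eq_one x (by rw [mul_comm]; exact hs.symm))
      · rw [hn, pow_succ] at hs
        refine Nat.find_min hex (m := k) (by omega) ⟨s', ?_⟩
        apply mul_right_cancel₀ hc0
        rw [hs]; ring
    rw [hs]
    exact (associated_mul_unit_right x s hsu).symm

end Quadratic

/-! ### Bad stable domains have divisible valuative normalization -/

section StableNormalization

variable {R : Type u} {F : Type v} [CommRing R] [IsDomain R] [IsLocalRing R] [Field F]
  [Algebra R F] [IsFractionRing R F]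

open IsLocalRing

theorem IsStableRing.hasDivisibleValuativeNormalization (hR : IsStableRing R)
    (hdim : ringKrullDim R = 1) (hfin : ¬ Module.Finite R (integralClosure R F)) :
    HasDivisibleValuativeNormalization R F := by
  obtain ⟨hfield, hrad⟩ := ringKrullDim_eq_one_iff_of_isLocalRing_isDomain.mp hdim
  have h1 : IsQuadraticExtension R (integralClosure R F) := hR.isQuadraticExtension
  have h2 : HasTwoGeneratedStability R (integralClosure R F) := hR.hasTwoGeneratedStability
  have hloc : IsLocalRing (integralClosure R F) := h1.isLocalRing h2 hfin
  have hval : ValuationRing (integralClosure R F) := h2.valuationRing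
  have hpow : ∀ {w y : integralClosure R F}, w ≠ 0 → ¬ IsUnit y → ∃ n, w ∣ y ^ n :=
    fun hw hy => exists_dvd_pow_of_quadratic h1 hrad hw hy
  have hinj : Function.Injective (algebraMap R (integralClosure R F)) := fun a b h =>
    IsFractionRing.injective R F (congrArg Subtype.val h)
  have : FaithfulSMul R (integralClosure R F) :=
    (faithfulSMul_iff_algebraMap_injective _ _).mpr hinj
  have hm : maximalIdeal R ≠ ⊥ := fun h =>
    hfield (IsLocalRing.isField_iff_maximalIdeal_eq.mpr h)
  obtain ⟨c, hcm, hcd, -⟩ := hR.exists_dvd hpow hm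
  have hc0 : c ≠ 0 := by
    rintro rfl
    refine hm ((Submodule.eq_bot_iff _).mpr fun y hy => ?_)
    have := hcd y hy
    rw [map_zero, zero_dvd_iff] at this
    exact (map_eq_zero_iff _ hinj).mp this
  have hcM : algebraMap R (integralClosure R F) c ∈ maximalIdeal (integralClosure R F) :=
    algebraMap_mem_maximalIdeal.mpr hcm
  have hM : ∀ y ∈ maximalIdeal (integralClosure R F), algebraMap R _ c ∣ y := fun y hy =>
    h1.dvd_of_mem_maximalIdeal hfin hc0 hcd
      (fun b hb hbd => hR.exists_mul_eq_mul hpow hm hb hbd) hy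
  have hcn : ∀ (n : ℕ) (y : integralClosure R F), ∃ (s : R) (z : integralClosure R F),
      y = algebraMap R _ s + algebraMap R _ c ^ n * z := by
    intro n
    induction n with
    | zero => exact fun y => ⟨0, y, by simp⟩
    | succ n ih =>
      intro y
      obtain ⟨s, z, hz⟩ := ih y
      obtain ⟨r, hr⟩ := h1.exists_sub_mem hfin z
      obtain ⟨w, hw⟩ := hM _ hr
      refine ⟨s + c ^ n * r, w, ?_⟩
      rw [hz, map_add, map_mul, map_pow]
      linear_combination (algebraMap R (integralClosure R F) c ^ n) * hw
  refine ⟨?_, ?_, ?_⟩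
  · exact isDiscreteValuationRing_of_forall_dvd hcM ((map_ne_zero_iff _ hinj).mpr hc0) hM
      fun w hw => hpow hw hcM
  · intro r hr y
    obtain ⟨n, k, hk⟩ := hpow ((map_ne_zero_iff _ hinj).mpr hr) hcM
    obtain ⟨s, z, hz⟩ := hcn n y
    exact ⟨s, k * z, by rw [hz, hk, mul_assoc]⟩
  · intro b c w y hcb p hp
    by_cases hb : b = 0
    · refine ⟨0, ?_⟩
      rw [hcb, hb]; simp
    -- In `I = bV ∩ R` the element `b` has least value, so `c p = b f` with `f ∈ R`, and cancelling
    -- `b` gives `c y = f`.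
    let I : Ideal R := Ideal.comap (algebraMap R (integralClosure R F))
      (Ideal.span {algebraMap R _ b})
    have hI : ∀ d, d ∈ I ↔ algebraMap R (integralClosure R F) b ∣ algebraMap R _ d := fun d => by
      rw [Ideal.mem_comap, Ideal.mem_span_singleton]
    have hbI : b ∈ I := (hI b).mpr dvd_rfl
    have hI0 : I ≠ ⊥ := fun h => hb (by rw [h] at hbI; exact hbI)
    obtain ⟨f, -, hf⟩ := hR.exists_mul_eq_mul hpow hI0 hbI (fun d hd => (hI d).mp hd)
      c ((hI c).mpr ⟨w, hcb⟩) p ((hI p).mpr ⟨y, hp.symm⟩)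
    refine ⟨f, mul_left_cancel₀ ((map_ne_zero_iff _ hinj).mpr hb) ?_⟩
    rw [← map_mul, ← hf, map_mul, ← hp]
    ring

theorem HasDivisibleValuativeNormalization.of_isBadStableDomain (h : IsBadStableDomain R) :
    HasDivisibleValuativeNormalization R F := by
  refine h.isStableRing.hasDivisibleValuativeNormalization h.ringKrullDim_eq_one fun hfin => ?_
  refine h.not_hasFiniteNormalization ?_
  have e : integralClosure R F ≃ₐ[R] integralClosure R (FractionRing R) :=
    (FractionRing.algEquiv R F).symm.mapIntegralClosure
  exact Module.Finite.equiv e.toLinearEquiv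

end StableNormalization

/-- Evaluation at `b` identifies the endomorphism ring with `I`; the inverse sends `c` to
multiplication by `c / b`. -/
theorem Ideal.isStableIdeal_of_forall_mul_eq {R : Type*} [CommRing R] [IsDomain R] {I : Ideal R}
    {b : R} (hb : b ∈ I) (hb0 : b ≠ 0) (h : ∀ y ∈ I, ∀ z ∈ I, ∃ f ∈ I, y * z = b * f) :
    I.IsStableIdeal := by
  have hbij : Function.Bijective
      (LinearMap.toSpanSingleton (Module.End R I) I (⟨b, hb⟩ : I)) := by
    constructor
    · rw [injective_iff_map_eq_zero]
      intro φ hφ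
      have hφ : φ ⟨b, hb⟩ = 0 := hφ
      ext y
      have h1 : b • y = (y : R) • (⟨b, hb⟩ : I) := by ext; simp [mul_comm]
      have h2 := congrArg φ h1
      rw [map_smul, map_smul, hφ, smul_zero] at h2
      have h3 : b * (φ y : R) = 0 := congrArg Subtype.val h2
      simpa using (mul_eq_zero.mp h3).resolve_left hb0
    · intro c
      choose f hf hfe using fun y : I => h c c.2 y y.2
      refine ⟨{ toFun := fun y => ⟨f y, hf y⟩, map_add' := ?_, map_smul' := ?_ }, ?_⟩
      · intro y z
        refine Subtype.ext (mul_left_cancel₀ hb0 ?_)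
        simp only [Submodule.coe_add, mul_add, ← hfe]
      · intro r y
        refine Subtype.ext (mul_left_cancel₀ hb0 ?_)
        simp only [RingHom.id_apply, Submodule.coe_smul, smul_eq_mul, mul_left_comm b, ← hfe]
        ring
      · refine Subtype.ext (mul_left_cancel₀ hb0 ?_)
        change b * f ⟨b, hb⟩ = _
        rw [← hfe, mul_comm]
  exact Module.Projective.of_equiv (LinearEquiv.ofBijective _ hbij)

theorem algebraMap_integralClosure_injective {R F : Type*} [CommRing R] [Field F] [Algebra R F]
    [IsFractionRing R F] : Function.Injective (algebraMap R (integralClosure R F)) :=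
  fun _ _ h => IsFractionRing.injective R F (congrArg Subtype.val h)

/-! ### Divisible valuative normalization implies bad stable -/

namespace HasDivisibleValuativeNormalization

variable {R : Type u} {F : Type v} [CommRing R] [IsDomain R] [IsLocalRing R] [Field F]
  [Algebra R F] [IsFractionRing R F]

open IsLocalRing

theorem exists_irreducible_algebraMap (h : HasDivisibleValuativeNormalization R F) :
    ∃ t ∈ maximalIdeal R, Irreducible (algebraMap R (integralClosure R F) t) := by
  have := h.isDiscreteValuationRing
  obtain ⟨ϖ, hϖ⟩ := IsDiscreteValuationRing.exists_irreducible (integralClosure R F)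
  obtain ⟨r, hr0, k, hr⟩ : ∃ r : R, r ≠ 0 ∧ ϖ ∣ algebraMap R _ r := by
    obtain ⟨a, b, hb, hab⟩ := IsFractionRing.div_surjective (A := R) (ϖ : F)
    have hb0 : algebraMap R F b ≠ 0 :=
      IsFractionRing.to_map_ne_zero_of_mem_nonZeroDivisors hb
    rw [div_eq_iff hb0] at hab
    refine ⟨a, ?_, algebraMap R _ b, Subtype.ext hab⟩
    rintro rfl
    rw [map_zero, eq_comm, mul_eq_zero] at hab
    exact hab.elim (fun h => hϖ.ne_zero (Subtype.ext h)) hb0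
  -- The square makes the correction divisible by `ϖ²`, so `t` is `ϖ` times a unit.
  obtain ⟨t, z, ht⟩ := h.exists_eq_add_mul (r ^ 2) (pow_ne_zero 2 hr0) ϖ
  have hassoc : algebraMap R _ t = ϖ * (1 - ϖ * (k ^ 2 * z)) := by
    rw [map_pow, hr] at ht
    linear_combination -ht
  have hunit : IsUnit (1 - ϖ * (k ^ 2 * z)) :=
    (isUnit_or_isUnit_one_sub_self _).resolve_left
      fun hu => hϖ.not_isUnit (isUnit_of_mul_isUnit_left hu)
  have hirr : Irreducible (algebraMap R (integralClosure R F) t) := by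
    rw [hassoc]
    exact (associated_mul_unit_right ϖ _ hunit).irreducible hϖ
  exact ⟨t, algebraMap_mem_maximalIdeal.mp hirr.not_isUnit, hirr⟩

theorem isStableRing (h : HasDivisibleValuativeNormalization R F) : IsStableRing R := by
  have := h.isDiscreteValuationRing
  have hinj := algebraMap_integralClosure_injective (R := R) (F := F)
  intro I hI
  obtain ⟨b, hb, hmin⟩ : ∃ b ∈ I, ∀ y ∈ I,
      algebraMap R (integralClosure R F) b ∣ algebraMap R _ y := by
    let f : I → ℕ∞ := fun y => IsDiscreteValuationRing.addVal _
      (algebraMap R (integralClosure R F) (y : R))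
    refine ⟨(Function.argmin f : I), Subtype.coe_prop _, fun y hy => ?_⟩
    rw [← IsDiscreteValuationRing.addVal_le_iff_dvd]
    exact Function.argmin_le f (⟨y, hy⟩ : I)
  have hb0 : b ≠ 0 := by
    rintro rfl
    refine hI ((Submodule.eq_bot_iff _).mpr fun y hy => ?_)
    have := hmin y hy
    rw [map_zero, zero_dvd_iff] at this
    exact (map_eq_zero_iff _ hinj).mp this
  refine Ideal.isStableIdeal_of_forall_mul_eq hb hb0 fun c hc d hd => ?_
  have key : ∀ c ∈ I, ∃ (r : R) (z : integralClosure R F),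
      algebraMap R _ (c - r * b) = algebraMap R _ (b ^ 2) * z := by
    intro c hc
    obtain ⟨y, hy⟩ := hmin c hc
    obtain ⟨r, z, hz⟩ := h.exists_eq_add_mul b hb0 y
    refine ⟨r, z, ?_⟩
    rw [map_sub, map_mul, map_pow, hy, hz]; ring
  obtain ⟨r, z, hz⟩ := key c hc
  obtain ⟨s, w, hw⟩ := key d hd
  -- With `c - r b = b² z` and `d - s b = b² w`, the element `(c - r b) w` lies in `R`, so `(c - r
  -- b)(d - s b) ∈ b² R`. Expanding shows `c d ∈ b I`.
  obtain ⟨p, hp⟩ := h.exists_mul_eq _ _ z w hz _ hw.symm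
  refine ⟨s * c + r * d - b * (r * s) + b * p, ?_, hinj ?_⟩
  · exact Ideal.add_mem _ (Ideal.sub_mem _ (Ideal.add_mem _ (Ideal.mul_mem_left _ _ hc)
      (Ideal.mul_mem_left _ _ hd)) (Ideal.mul_mem_right _ _ hb)) (Ideal.mul_mem_right _ _ hb)
  · simp only [map_sub, map_mul, map_add, map_pow] at hz hw hp ⊢
    rw [← hp]
    linear_combination (algebraMap R _ c - algebraMap R _ r * algebraMap R _ b) * hw

theorem ringKrullDim_eq_one (h : HasDivisibleValuativeNormalization R F) :
    ringKrullDim R = 1 := by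
  have := h.isDiscreteValuationRing
  have hinj := algebraMap_integralClosure_injective (R := R) (F := F)
  obtain ⟨t, ht, hirr⟩ := h.exists_irreducible_algebraMap
  rw [ringKrullDim_eq_one_iff_of_isLocalRing_isDomain]
  refine ⟨fun hf => ?_, fun x hx y hy => ?_⟩
  · rw [IsLocalRing.isField_iff_maximalIdeal_eq] at hf
    rw [hf, Ideal.mem_bot] at ht
    rw [ht, map_zero] at hirr
    exact hirr.ne_zero rfl
  · obtain ⟨n, hn⟩ := IsDiscreteValuationRing.associated_pow_irreducible
      ((map_ne_zero_iff _ hinj).mpr hx) hirr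
    have hty : algebraMap R (integralClosure R F) t ∣ algebraMap R _ y := by
      have : algebraMap R (integralClosure R F) y ∈ maximalIdeal _ :=
        algebraMap_mem_maximalIdeal.mpr hy
      rwa [hirr.maximalIdeal_eq, Ideal.mem_span_singleton] at this
    obtain ⟨w, hw⟩ := hn.dvd.trans (pow_dvd_pow_of_dvd hty n)
    rw [← map_pow] at hw
    -- Here `yⁿ = x w` with `w` perhaps outside `R`, but `yⁿ w ∈ R`; hence the exponent `2n`.
    obtain ⟨s, hs⟩ := h.exists_mul_eq x (y ^ n) w w hw (y ^ n) hw.symm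
    refine ⟨n + n, Ideal.mem_span_singleton.mpr ⟨s, hinj ?_⟩⟩
    rw [pow_add, map_mul, map_mul, ← hs]
    linear_combination (algebraMap R _ (y ^ n)) * hw

theorem not_finite (h : HasDivisibleValuativeNormalization R F)
    (hR : ¬ IsDiscreteValuationRing R) : ¬ Module.Finite R (integralClosure R F) := by
  intro hfin
  have := h.isDiscreteValuationRing
  have hinj := algebraMap_integralClosure_injective (R := R) (F := F)
  have hfg : (Subalgebra.toSubmodule (integralClosure R F)).FG := Module.Finite.iff_fg.mp hfin
  obtain ⟨d, hd, hdV⟩ := FractionalIdeal.isFractional_of_fg (S := nonZeroDivisors R) hfg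
  have hsurj : Function.Surjective (algebraMap R (integralClosure R F)) := by
    intro y
    obtain ⟨s, z, hz⟩ := h.exists_eq_add_mul d (nonZeroDivisors.ne_zero hd) y
    obtain ⟨r, hr⟩ := hdV z z.2
    refine ⟨s + r, ?_⟩
    rw [hz, map_add]
    congr 1
    refine Subtype.ext ?_
    change algebraMap R F r = algebraMap R F d * z
    rw [hr, Algebra.smul_def]
  exact hR (IsDiscreteValuationRing.RingEquivClass.isDiscreteValuationRing
    (RingEquiv.ofBijective (algebraMap R (integralClosure R F)) ⟨hinj, hsurj⟩).symm)

theorem isBadStableDomain (h : HasDivisibleValuativeNormalization R F)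
    (hR : ¬ IsDiscreteValuationRing R) : IsBadStableDomain R where
  isDomain := inferInstance
  isLocalRing := inferInstance
  isStableRing := h.isStableRing
  ringKrullDim_eq_one := h.ringKrullDim_eq_one
  not_hasFiniteNormalization hfin := by
    refine h.not_finite hR ?_
    have hfin : Module.Finite R (integralClosure R (FractionRing R)) := hfin
    have e : integralClosure R (FractionRing R) ≃ₐ[R] integralClosure R F :=
      (FractionRing.algEquiv R F).mapIntegralClosure
    exact Module.Finite.equiv e.toLinearEquiv

end HasDivisibleValuativeNormalization

theorem DirectSum.exists_smul_eq {R ι : Type*} [CommRing R] {M : ι → Type*}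
    [∀ i, AddCommGroup (M i)] [∀ i, Module R (M i)] {r : R}
    (h : ∀ i, ∀ x : M i, ∃ y, r • y = x) (z : ⨁ i, M i) : ∃ z', r • z' = z := by
  classical
  induction z using DirectSum.induction_on with
  | zero => exact ⟨0, smul_zero r⟩
  | of i x =>
    obtain ⟨y, rfl⟩ := h i x
    exact ⟨DirectSum.lof R ι M i y, (map_smul _ r y).symm⟩
  | add x y hx hy =>
    obtain ⟨x', rfl⟩ := hx
    obtain ⟨y', rfl⟩ := hy
    exact ⟨x' + y', smul_add r x' y'⟩

/-! ### The socle as a vector space over the residue field -/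

section Socle

open IsLocalRing

variable {R L : Type*} [CommRing R] [IsLocalRing R] [AddCommGroup L] [Module R L]

/-- A basis, over the residue field, of the socle `{x | t x = 0}` of `L`. -/
theorem exists_socle_basis {t : R} (ht : t ∈ maximalIdeal R)
    (hsoc : ∀ x : L, t • x = 0 → ∀ b ∈ maximalIdeal R, b • x = 0) :
    ∃ (B : Set L), (∀ i ∈ B, t • i = 0) ∧ (∀ x : L, t • x = 0 → x ∈ Submodule.span R B) ∧
      ∀ (s : Finset B) (r : B → R), ∑ i ∈ s, r i • (i : L) = 0 →
        ∀ i ∈ s, r i ∈ maximalIdeal R := by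
  let S := Submodule.torsionBySet R L (maximalIdeal R : Set R)
  have hS : ∀ x, x ∈ S ↔ t • x = 0 := fun x => by
    rw [Submodule.mem_torsionBySet_iff]
    exact ⟨fun h => h ⟨t, ht⟩, fun h b => hsoc x h b b.2⟩
  let := Ideal.Quotient.field (maximalIdeal R)
  let b := Module.Basis.ofVectorSpaceIndex (R ⧸ maximalIdeal R) S
  have hli : LinearIndependent (R ⧸ maximalIdeal R) ((↑) : b → S) :=
    Module.Basis.ofVectorSpaceIndex.linearIndependent _ _
  have hspan : Submodule.span R b = ⊤ := by
    have h1 : Submodule.span (R ⧸ maximalIdeal R) b = ⊤ := by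
      have := (Module.Basis.ofVectorSpace (R ⧸ maximalIdeal R) S).span_eq
      rwa [Module.Basis.range_ofVectorSpace] at this
    rw [← Submodule.restrictScalars_span R (R ⧸ maximalIdeal R) Ideal.Quotient.mk_surjective, h1,
      Submodule.restrictScalars_top]
  refine ⟨Subtype.val '' b, ?_, ?_, ?_⟩
  · rintro _ ⟨i, -, rfl⟩
    exact (hS i).mp i.2
  · intro x hx
    have h1 : (⟨x, (hS x).mpr hx⟩ : S) ∈ Submodule.span R b := by rw [hspan]; trivial
    have h2 := Submodule.mem_map_of_mem (f := S.subtype) h1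
    rw [Submodule.map_span] at h2
    exact h2
  · intro s r hsum
    have hmem : ∀ i : (Subtype.val '' b : Set L), ∃ j : b, ((j : S) : L) = i := by
      rintro ⟨_, j, hj, rfl⟩; exact ⟨⟨j, hj⟩, rfl⟩
    choose g hg using hmem
    have hginj : Function.Injective g := fun i j hij => by
      refine Subtype.ext ?_
      rw [← hg, ← hg, hij]
    have hli' := hli.comp g hginj
    rw [linearIndependent_iff'] at hli'
    intro i hi
    rw [← Ideal.Quotient.eq_zero_iff_mem]
    refine hli' s (fun i => Ideal.Quotient.mk _ (r i)) ?_ i hi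
    refine Subtype.ext ?_
    rw [AddSubmonoidClass.coe_finsetSum]
    refine Eq.trans (Finset.sum_congr rfl fun i _ => ?_) hsum
    rw [← hg i]
    rfl

end Socle

/-! ### Decomposition into copies of `F/V` -/

namespace HasDivisibleValuativeNormalization

theorem fieldModNormalization_exists_smul_eq {R F : Type*} [CommRing R] [Field F]
    [Algebra R F] [IsFractionRing R F] {r : R} (hr : r ≠ 0)
    (q : FieldModNormalization R F) : ∃ q', r • q' = q := by
  have hr' : algebraMap R F r ≠ 0 := (map_ne_zero_iff _ (IsFractionRing.injective R F)).mpr hr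
  obtain ⟨z, rfl⟩ := Submodule.Quotient.mk_surjective _ q
  refine ⟨Submodule.Quotient.mk ((algebraMap R F r)⁻¹ * z), ?_⟩
  rw [← Submodule.Quotient.mk_smul, Algebra.smul_def, mul_inv_cancel_left₀ hr']

theorem fieldModNormalization_exists_smul {R F : Type*} [CommRing R] [Field F] [Algebra R F]
    [IsFractionRing R F] (h : HasDivisibleValuativeNormalization R F) {t : R}
    (ht : Irreducible (algebraMap R (integralClosure R F) t)) (q : FieldModNormalization R F)
    (hq : t • q = 0) : ∃ r : R, q = r • Submodule.Quotient.mk (algebraMap R F t)⁻¹ := by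
  have ht0 : t ≠ 0 := by rintro rfl; rw [map_zero] at ht; exact ht.ne_zero rfl
  have ht0' : algebraMap R F t ≠ 0 := (map_ne_zero_iff _ (IsFractionRing.injective R F)).mpr ht0
  obtain ⟨z, rfl⟩ := Submodule.Quotient.mk_surjective _ q
  rw [← Submodule.Quotient.mk_smul, Submodule.Quotient.mk_eq_zero] at hq
  obtain ⟨r, v, hv⟩ := h.exists_eq_add_mul t ht0 ⟨t • z, hq⟩
  have hv' : t • z = algebraMap R F r + algebraMap R F t * v := congrArg Subtype.val hv
  refine ⟨r, ?_⟩
  rw [← Submodule.Quotient.mk_smul, Submodule.Quotient.eq]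
  have : z - r • (algebraMap R F t)⁻¹ = v := by
    rw [Algebra.smul_def] at hv' ⊢
    field_simp
    linear_combination hv'
  rw [this]; exact v.2

open IsLocalRing

variable {R : Type u} {F : Type v} [CommRing R] [IsDomain R] [IsLocalRing R] [Field F]
  [Algebra R F] [IsFractionRing R F]

theorem exists_algebraMap_dvd_pow (h : HasDivisibleValuativeNormalization R F) {t : R}
    (ht : Irreducible (algebraMap R (integralClosure R F) t)) {b : R} (hb : b ≠ 0) :
    ∃ n, algebraMap R (integralClosure R F) b ∣ algebraMap R _ (t ^ n) := by
  have := h.isDiscreteValuationRing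
  obtain ⟨n, hn⟩ := IsDiscreteValuationRing.associated_pow_irreducible
    ((map_ne_zero_iff _ algebraMap_integralClosure_injective).mpr hb) ht
  exact ⟨n, by rw [map_pow]; exact hn.dvd⟩

/-- Modulo `V`, the fractions `r / tⁿ` with `r ∈ R` exhaust `F`, so a map out of `F/V` is determined
by the images of the `t⁻ⁿ`. -/
theorem exists_sub_div_pow_isIntegral (h : HasDivisibleValuativeNormalization R F) {t : R}
    (ht : Irreducible (algebraMap R (integralClosure R F) t)) (z : F) :
    ∃ (n : ℕ) (r : R), z - algebraMap R F r / algebraMap R F t ^ n ∈ integralClosure R F := by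
  have ht0 : t ≠ 0 := by rintro rfl; rw [map_zero] at ht; exact ht.ne_zero rfl
  have ht0' : algebraMap R F t ≠ 0 := (map_ne_zero_iff _ (IsFractionRing.injective R F)).mpr ht0
  obtain ⟨a, b, hb, rfl⟩ := IsFractionRing.div_surjective (A := R) z
  have hb0 : algebraMap R F b ≠ 0 := IsFractionRing.to_map_ne_zero_of_mem_nonZeroDivisors hb
  obtain ⟨n, w, hw⟩ := h.exists_algebraMap_dvd_pow ht (nonZeroDivisors.ne_zero hb)
  obtain ⟨r, v, hv⟩ := h.exists_eq_add_mul (t ^ n) (pow_ne_zero n ht0) (algebraMap R _ a * w)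
  have hw' : algebraMap R F (t ^ n) = algebraMap R F b * w := congrArg Subtype.val hw
  have hv' : algebraMap R F a * w = algebraMap R F r + algebraMap R F (t ^ n) * v :=
    congrArg Subtype.val hv
  refine ⟨n, r, ?_⟩
  have : algebraMap R F a / algebraMap R F b - algebraMap R F r / algebraMap R F t ^ n = v := by
    rw [map_pow] at hw' hv'
    have htn := pow_ne_zero n ht0'
    field_simp
    linear_combination (algebraMap R F b) * hv' + (algebraMap R F a) * hw'
  rw [this]; exact v.2

variable {L : Type*} [AddCommGroup L] [Module R L]

/-- Socle elements of a divisible module `L` whose annihilators depend only on valuations are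
images of `1 / t` under linear maps `F / V → L`. -/
theorem exists_linearMap (h : HasDivisibleValuativeNormalization R F) {t : R}
    (ht : Irreducible (algebraMap R (integralClosure R F) t))
    (hdiv : ∀ x : L, ∃ y : L, t • y = x)
    (hann : ∀ (b c : R) (w : integralClosure R F), algebraMap R _ c = algebraMap R _ b * w →
      ∀ x : L, b • x = 0 → c • x = 0) {e : L} (he : t • e = 0) :
    ∃ f : FieldModNormalization R F →ₗ[R] L,
      f (Submodule.Quotient.mk (algebraMap R F t)⁻¹) = e := by
  have ht0 : t ≠ 0 := by rintro rfl; rw [map_zero] at ht; exact ht.ne_zero rfl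
  have ht0' : algebraMap R F t ≠ 0 := (map_ne_zero_iff _ (IsFractionRing.injective R F)).mpr ht0
  choose d hd using hdiv
  -- `x n` is the intended image of `t⁻ⁿ`: `x 0 = 0`, `x 1 = e`, and `t • x (n + 1) = x n` by
  -- divisibility.
  let x : ℕ → L := fun n => Nat.casesOn n 0 fun n => d^[n] e
  have hx : ∀ n, t • x (n + 1) = x n := by
    intro n
    rcases n with _ | n
    · exact he
    · change t • d^[n + 1] e = d^[n] e
      rw [Function.iterate_succ_apply', hd]
  have hxk : ∀ k n, t ^ k • x (n + k) = x n := by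
    intro k
    induction k with
    | zero => intro n; simp
    | succ k ih => intro n; rw [pow_succ, mul_smul, ← add_assoc, hx, ih]
  have hx0 : ∀ n, t ^ n • x n = 0 := by
    intro n
    have := hxk n 0
    rwa [zero_add] at this
  -- Fractions congruent modulo `V` have the same image: over the common denominator the numerators
  -- differ by a multiple in `V` of `t ^ (n + n')`, which kills `x (n + n')`.
  have hwd : ∀ (r r' : R) (n n' : ℕ), algebraMap R F r / algebraMap R F t ^ n
      - algebraMap R F r' / algebraMap R F t ^ n' ∈ integralClosure R F →
      r • x n = r' • x n' := by
    intro r r' n n' hmem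
    have h1 : (r * t ^ n' - r' * t ^ n) • x (n + n') = 0 := by
      refine hann (t ^ (n + n')) _ ⟨_, hmem⟩ (Subtype.ext ?_) _ (hx0 _)
      change algebraMap R F (r * t ^ n' - r' * t ^ n) = algebraMap R F (t ^ (n + n')) *
        (algebraMap R F r / algebraMap R F t ^ n - algebraMap R F r' / algebraMap R F t ^ n')
      simp only [map_sub, map_mul, map_pow, pow_add]
      field_simp
    rw [sub_smul, sub_eq_zero, mul_smul, mul_smul, hxk, add_comm n n', hxk] at h1
    exact h1
  choose N ρ hρ using fun z : F => h.exists_sub_div_pow_isIntegral ht z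
  have hval : ∀ (z : F) (r : R) (n : ℕ), z - algebraMap R F r / algebraMap R F t ^ n
      ∈ integralClosure R F → ρ z • x (N z) = r • x n := by
    intro z r n hz
    refine hwd _ _ _ _ ?_
    have := (integralClosure R F).sub_mem hz (hρ z)
    rwa [sub_sub_sub_cancel_left] at this
  let g : F →ₗ[R] L :=
    { toFun := fun z => ρ z • x (N z)
      map_add' := fun z z' => by
        have h1 : ρ z • x (N z) = (ρ z * t ^ N z') • x (N z + N z') := by
          rw [mul_smul, hxk]
        have h2 : ρ z' • x (N z') = (ρ z' * t ^ N z) • x (N z + N z') := by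
          rw [mul_smul, add_comm, hxk]
        rw [h1, h2, ← add_smul]
        refine hval _ _ _ ?_
        have := (integralClosure R F).add_mem (hρ z) (hρ z')
        convert this using 1
        simp only [map_add, map_mul, map_pow, pow_add]
        field_simp
        ring
      map_smul' := fun r z => by
        rw [RingHom.id_apply, smul_smul]
        refine hval _ _ _ ?_
        have := (integralClosure R F).smul_mem (hρ z) r
        convert this using 1
        simp only [Algebra.smul_def, map_mul]
        ring }
  refine ⟨Submodule.liftQ _ g ?_, ?_⟩
  · intro z hz
    have hz : z ∈ integralClosure R F := hz
    rw [LinearMap.mem_ker]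
    have := hval z 0 0 (by simpa using hz)
    rw [zero_smul] at this
    exact this
  · have h1 := hval (algebraMap R F t)⁻¹ 1 1
      (by rw [map_one, pow_one, one_div, sub_self]; exact (integralClosure R F).zero_mem)
    rw [one_smul] at h1
    exact h1

theorem fieldModNormalization_exists_pow_smul_eq_zero
    (h : HasDivisibleValuativeNormalization R F) {t : R}
    (ht : Irreducible (algebraMap R (integralClosure R F) t)) (q : FieldModNormalization R F) :
    ∃ n, t ^ n • q = 0 := by
  have ht0 : t ≠ 0 := by rintro rfl; rw [map_zero] at ht; exact ht.ne_zero rfl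
  have ht0' : algebraMap R F t ≠ 0 := (map_ne_zero_iff _ (IsFractionRing.injective R F)).mpr ht0
  obtain ⟨z, rfl⟩ := Submodule.Quotient.mk_surjective _ q
  obtain ⟨n, r, hr⟩ := h.exists_sub_div_pow_isIntegral ht z
  refine ⟨n, ?_⟩
  rw [← Submodule.Quotient.mk_smul, Submodule.Quotient.mk_eq_zero]
  have : t ^ n • z = t ^ n • (z - algebraMap R F r / algebraMap R F t ^ n) + algebraMap R F r := by
    simp only [Algebra.smul_def, map_pow]
    field_simp
    ring
  rw [this]
  exact (integralClosure R F).add_mem ((integralClosure R F).smul_mem hr _)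
    ((integralClosure R F).algebraMap_mem r)

/-- A divisible torsion module whose annihilators depend only on valuations is a direct sum of
copies of `F / V`. -/
theorem exists_linearEquiv_directSum (h : HasDivisibleValuativeNormalization R F) {t : R}
    (htm : t ∈ maximalIdeal R) (ht : Irreducible (algebraMap R (integralClosure R F) t))
    (htors : ∀ x : L, ∃ n, t ^ n • x = 0) (hdiv : ∀ x : L, ∃ y : L, t • y = x)
    (hann : ∀ (b c : R) (w : integralClosure R F), algebraMap R _ c = algebraMap R _ b * w →
      ∀ x : L, b • x = 0 → c • x = 0) :
    ∃ B : Set L, Nonempty (L ≃ₗ[R] ⨁ _ : B, FieldModNormalization R F) := by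
  classical
  have := h.isDiscreteValuationRing
  obtain ⟨B, hB0, hBspan, hBind⟩ := exists_socle_basis (L := L) htm fun x hx b hb => by
    have hb' : algebraMap R (integralClosure R F) b ∈ maximalIdeal _ :=
      algebraMap_mem_maximalIdeal.mpr hb
    rw [ht.maximalIdeal_eq, Ideal.mem_span_singleton] at hb'
    obtain ⟨w, hw⟩ := hb'
    exact hann t b w hw x hx
  choose f hf using fun i : B => h.exists_linearMap ht hdiv hann (hB0 i i.2)
  let Φ : (⨁ _ : B, FieldModNormalization R F) →ₗ[R] L := DirectSum.toModule R B L f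
  have hΦ : ∀ i q, Φ (DirectSum.lof R B (fun _ => FieldModNormalization R F) i q) = f i q :=
    fun i q => DirectSum.toModule_lof (M := fun _ : B => FieldModNormalization R F) (φ := f) R i q
  have hzero : ∀ r ∈ maximalIdeal R, r • (Submodule.Quotient.mk (algebraMap R F t)⁻¹ :
      FieldModNormalization R F) = 0 := by
    intro r hr
    have hr' : algebraMap R (integralClosure R F) r ∈ maximalIdeal _ :=
      algebraMap_mem_maximalIdeal.mpr hr
    rw [ht.maximalIdeal_eq, Ideal.mem_span_singleton] at hr'
    obtain ⟨w, hw⟩ := hr'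
    have hw' : algebraMap R F r = algebraMap R F t * w := congrArg Subtype.val hw
    have ht0' : algebraMap R F t ≠ 0 := fun h0 => ht.ne_zero (Subtype.ext h0)
    rw [← Submodule.Quotient.mk_smul, Submodule.Quotient.mk_eq_zero, Algebra.smul_def, hw',
      mul_right_comm, mul_inv_cancel₀ ht0', one_mul]
    exact w.2
  have hsocle : ∀ z, t • z = 0 → Φ z = 0 → z = 0 := by
    intro z htz hz
    have hcomp : ∀ i, ∃ r : R, z i = r • Submodule.Quotient.mk (algebraMap R F t)⁻¹ := fun i =>
      h.fieldModNormalization_exists_smul ht (z i) 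
        (congrArg (fun y : ⨁ _ : B, FieldModNormalization R F => y i) htz)
    choose r hr using hcomp
    have hsum : ∑ i ∈ DFinsupp.support z, r i • (i : L) = 0 := by
      rw [← hz]
      conv_rhs => rw [← DirectSum.sum_support_of z, map_sum]
      refine Finset.sum_congr rfl fun i _ => ?_
      have h1 := hΦ i (z i)
      rw [congrArg (f i) (hr i), map_smul, hf] at h1
      exact h1.symm
    ext i
    by_cases hi : i ∈ DFinsupp.support z
    · rw [hr, hzero _ (hBind _ r hsum i hi)]; rfl
    · exact DFinsupp.notMem_support_iff.mp hi
  -- Every element is killed by a power of `t`, so a nonzero kernel would meet the socle.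
  have hinj : Function.Injective Φ := by
    rw [injective_iff_map_eq_zero]
    have hn : ∀ n z, t ^ n • z = 0 → Φ z = 0 → z = 0 := by
      intro n
      induction n with
      | zero => intro z hz _; simpa using hz
      | succ n ih =>
        intro z hz hΦz
        refine hsocle z (ih (t • z) ?_ ?_) hΦz
        · rw [smul_smul, ← pow_succ, hz]
        · rw [map_smul, hΦz, smul_zero]
    intro z hz
    obtain ⟨n, hnz⟩ : ∃ n, t ^ n • z = 0 := by
      clear hz
      induction z using DirectSum.induction_on with
      | zero => exact ⟨0, smul_zero _⟩
      | of i q =>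
        obtain ⟨n, hn⟩ := h.fieldModNormalization_exists_pow_smul_eq_zero ht q
        refine ⟨n, ?_⟩
        change t ^ n • DirectSum.lof R B (fun _ => FieldModNormalization R F) i q = 0
        rw [← map_smul, hn, map_zero]
      | add x y hx hy =>
        obtain ⟨n, hn⟩ := hx
        obtain ⟨m, hm⟩ := hy
        refine ⟨n + m, ?_⟩
        rw [smul_add, pow_add, mul_smul _ _ y, hm, mul_comm, mul_smul, hn, smul_zero, smul_zero,
          add_zero]
    exact hn n z hnz hz
  -- The range is divisible and contains the socle, so induction on the power of `t` killing `x`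
  -- applies.
  have hsurj : Function.Surjective Φ := by
    have ht0 : t ≠ 0 := by rintro rfl; rw [map_zero] at ht; exact ht.ne_zero rfl
    have hBrange : Submodule.span R B ≤ LinearMap.range Φ := by
      rw [Submodule.span_le]
      intro i hi
      exact ⟨_, (hΦ ⟨i, hi⟩ _).trans (hf ⟨i, hi⟩)⟩
    have hn : ∀ n (x : L), t ^ n • x = 0 → x ∈ LinearMap.range Φ := by
      intro n
      induction n with
      | zero => intro x hx; rw [pow_zero, one_smul] at hx; rw [hx]; exact zero_mem _
      | succ n ih =>
        intro x hx
        obtain ⟨z, hz⟩ := ih (t • x) (by rw [smul_smul, ← pow_succ, hx])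
        obtain ⟨z', rfl⟩ := DirectSum.exists_smul_eq
          (fun _ => fieldModNormalization_exists_smul_eq ht0) z
        rw [map_smul] at hz
        have h1 : x - Φ z' ∈ LinearMap.range Φ :=
          hBrange (hBspan _ (by rw [smul_sub, hz, sub_self]))
        have h2 := Submodule.add_mem _ h1 (LinearMap.mem_range_self Φ z')
        rwa [sub_add_cancel] at h2
    intro x
    obtain ⟨n, hx⟩ := htors x
    exact hn n x hx
  exact ⟨B, ⟨(LinearEquiv.ofBijective Φ ⟨hinj, hsurj⟩).symm⟩⟩

theorem exists_normalizationModSelf_linearEquiv (h : HasDivisibleValuativeNormalization R F) :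
    ∃ B : Type v, Nonempty
      (NormalizationModSelf R F ≃ₗ[R] ⨁ _ : B, FieldModNormalization R F) := by
  obtain ⟨t, htm, ht⟩ := h.exists_irreducible_algebraMap
  have ht0 : t ≠ 0 := by rintro rfl; rw [map_zero] at ht; exact ht.ne_zero rfl
  have hann : ∀ (b c : R) (w : integralClosure R F), algebraMap R _ c = algebraMap R _ b * w →
      ∀ x : NormalizationModSelf R F, b • x = 0 → c • x = 0 := by
    intro b c w hw x hx
    obtain ⟨y, rfl⟩ := Submodule.Quotient.mk_surjective _ x
    rw [← Submodule.Quotient.mk_smul, Submodule.Quotient.mk_eq_zero] at hx ⊢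
    obtain ⟨p, hp⟩ := hx
    obtain ⟨s, hs⟩ := h.exists_mul_eq b c w y hw p (by rw [← Algebra.smul_def]; exact hp.symm)
    exact ⟨s, by rw [Algebra.smul_def]; exact hs.symm⟩
  obtain ⟨B, hB⟩ := h.exists_linearEquiv_directSum (L := NormalizationModSelf R F) htm ht
    (fun x => by
      obtain ⟨y, rfl⟩ := Submodule.Quotient.mk_surjective _ x
      obtain ⟨a, b, hb, hab⟩ := IsFractionRing.div_surjective (A := R) (y : F)
      have hb0 : algebraMap R F b ≠ 0 :=
        IsFractionRing.to_map_ne_zero_of_mem_nonZeroDivisors hb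
      obtain ⟨n, w, hw⟩ := h.exists_algebraMap_dvd_pow ht (nonZeroDivisors.ne_zero hb)
      refine ⟨n, hann b _ w hw _ ?_⟩
      rw [← Submodule.Quotient.mk_smul, Submodule.Quotient.mk_eq_zero]
      refine ⟨a, Subtype.ext ?_⟩
      change algebraMap R F a = b • (y : F)
      rw [← hab, Algebra.smul_def, mul_div_cancel₀ _ hb0])
    (fun x => by
      obtain ⟨y, rfl⟩ := Submodule.Quotient.mk_surjective _ x
      obtain ⟨s, z, hz⟩ := h.exists_eq_add_mul t ht0 y
      refine ⟨Submodule.Quotient.mk z, ?_⟩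
      rw [← Submodule.Quotient.mk_smul, eq_comm, Submodule.Quotient.eq]
      exact ⟨s, by rw [hz, Algebra.smul_def, add_sub_cancel_right]; rfl⟩)
    hann
  exact ⟨B, hB⟩

end HasDivisibleValuativeNormalization

section DirectSum

variable {R ι : Type*} [CommRing R] {M : ι → Type*} [∀ i, AddCommGroup (M i)]
  [∀ i, Module R (M i)]

theorem DirectSum.smul_eq_zero_of_forall {b c : R} (h : ∀ i, ∀ x : M i, b • x = 0 → c • x = 0)
    (z : ⨁ i, M i) (hz : b • z = 0) : c • z = 0 := by
  refine DFinsupp.ext fun i => ?_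
  exact h i (z i) (congrArg (fun y : ⨁ i, M i => y i) hz)

end DirectSum

/-! ### Annihilators in divisible uniserial modules -/

section Uniserial

variable {R : Type u} {F : Type v} [CommRing R] [IsDomain R] [Field F]
  [Algebra R F] [IsFractionRing R F]

theorem annihilator_le_of_mul {N : Type*} [AddCommGroup N] [Module R N]
    (hdiv : IsDivisibleModule R N) {a b c : R} (ha : a ≠ 0)
    (h : ∀ x : N, (a * b) • x = 0 → (a * c) • x = 0) (x : N) (hx : b • x = 0) : c • x = 0 := by
  obtain ⟨y, rfl⟩ := hdiv a (mem_nonZeroDivisors_of_ne_zero ha) x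
  have := h y (by rw [mul_comm, mul_smul, hx])
  rwa [mul_comm, mul_smul] at this

/-- In a uniserial module, the fractions `c / b` such that `c` kills everything killed by
`b` form a valuation ring. -/
def uniserialValuationSubring (F : Type v) [Field F] [Algebra R F] [IsFractionRing R F]
    {N : Type*} [AddCommGroup N] [Module R N] (huni : IsUniserialModule R N) : ValuationSubring F where
  carrier := {f | ∃ b c : R, b ≠ 0 ∧ f * algebraMap R F b = algebraMap R F c ∧
    ∀ x : N, b • x = 0 → c • x = 0}
  mul_mem' := by
    rintro f f' ⟨b, c, hb, hf, h⟩ ⟨b', c', hb', hf', h'⟩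
    refine ⟨b * b', c * c', mul_ne_zero hb hb', ?_, fun x hx => ?_⟩
    · rw [map_mul, map_mul, ← hf, ← hf']; ring
    · rw [mul_smul] at hx
      have h1 := h _ hx
      rw [smul_comm] at h1
      have h2 := h' _ h1
      rwa [smul_comm, ← mul_smul] at h2
  one_mem' := ⟨1, 1, one_ne_zero, by simp, fun x hx => hx⟩
  add_mem' := by
    rintro f f' ⟨b, c, hb, hf, h⟩ ⟨b', c', hb', hf', h'⟩
    refine ⟨b * b', c * b' + c' * b, mul_ne_zero hb hb', ?_, fun x hx => ?_⟩
    · rw [map_mul, map_add, map_mul, map_mul, ← hf, ← hf']; ring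
    · have h1 := h (b' • x) (by rw [smul_smul, hx])
      have h2 := h' (b • x) (by rw [smul_smul, mul_comm, hx])
      rw [add_smul, mul_smul, mul_smul, h1, h2, add_zero]
  zero_mem' := ⟨1, 0, one_ne_zero, by simp, fun x _ => zero_smul R x⟩
  neg_mem' := by
    rintro f ⟨b, c, hb, hf, h⟩
    exact ⟨b, -c, hb, by rw [map_neg, ← hf, neg_mul], fun x hx => by rw [neg_smul, h x hx, neg_zero]⟩
  mem_or_inv_mem' := by
    intro f
    obtain ⟨c, b, hb, rfl⟩ := IsFractionRing.div_surjective (A := R) f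
    have hb0 : algebraMap R F b ≠ 0 := IsFractionRing.to_map_ne_zero_of_mem_nonZeroDivisors hb
    rcases huni (LinearMap.ker (LinearMap.lsmul R N b)) (LinearMap.ker (LinearMap.lsmul R N c))
      with h | h
    · exact Or.inl ⟨b, c, nonZeroDivisors.ne_zero hb, div_mul_cancel₀ _ hb0, fun x hx => h hx⟩
    · by_cases hc : c = 0
      · left
        exact ⟨1, 0, one_ne_zero, by simp [hc], fun x _ => zero_smul R x⟩
      · have hc0 : algebraMap R F c ≠ 0 :=
          (map_ne_zero_iff _ (IsFractionRing.injective R F)).mpr hc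
        right
        exact ⟨c, b, hc, by rw [inv_div, div_mul_cancel₀ _ hc0], fun x hx => h hx⟩

/-- The valuation ring attached to `N` contains `R` and is integrally closed, so it contains `w`.
Thus `w = c' / b'` with an inclusion of annihilators; `b' c = b c'` carries it to `b' b` and `b' c`,
and divisibility cancels `b'`. -/
theorem smul_eq_zero_of_uniserial {N : Type*} [AddCommGroup N] [Module R N]
    (hdiv : IsDivisibleModule R N) (huni : IsUniserialModule R N) {b c : R}
    {w : integralClosure R F} (hw : algebraMap R _ c = algebraMap R _ b * w) (x : N)
    (hx : b • x = 0) : c • x = 0 := by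
  have hinj := IsFractionRing.injective R F
  have hw' : algebraMap R F c = algebraMap R F b * w := congrArg Subtype.val hw
  by_cases hb : b = 0
  · rw [hb, map_zero, zero_mul] at hw'
    rw [(map_eq_zero_iff _ hinj).mp hw', zero_smul]
  let O := uniserialValuationSubring F huni
  have hO : ∀ r, algebraMap R F r ∈ O := fun r =>
    ⟨1, r, one_ne_zero, by simp, fun x hx => by rw [one_smul] at hx; rw [hx, smul_zero]⟩
  have hmem : (w : F) ∈ O := by
    have hint : IsIntegral O (w : F) := by
      obtain ⟨p, hp, hpw⟩ := w.2
      let φ : R →+* O := (algebraMap R F).codRestrict O.toSubring hO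
      refine ⟨p.map φ, hp.map φ, ?_⟩
      rw [Polynomial.eval₂_map]
      exact hpw
    obtain ⟨y, hy⟩ := IsIntegrallyClosed.isIntegral_iff.mp hint
    rw [← hy]; exact y.2
  obtain ⟨b', c', hb', hf, h⟩ := hmem
  have hcb : b' * c = b * c' := by
    refine hinj ?_
    rw [map_mul, map_mul, hw', ← hf]; ring
  refine annihilator_le_of_mul hdiv hb' (fun y hy => ?_) x hx
  rw [hcb, mul_smul, smul_comm]
  exact h _ (by rwa [← mul_smul])

end Uniserial

/-! ### Recovering the condition from direct sums; structure of `F/V` -/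

namespace HasDivisibleValuativeNormalization

open IsLocalRing

variable {R : Type u} {F : Type v} [CommRing R] [IsDomain R] [Field F]
  [Algebra R F] [IsFractionRing R F]

theorem of_linearEquiv_directSum {R F : Type*} [CommRing R] [Field F] [Algebra R F]
    [IsDiscreteValuationRing (integralClosure R F)]
    {ι : Type*} {M : ι → Type*} [∀ i, AddCommGroup (M i)] [∀ i, Module R (M i)]
    (e : NormalizationModSelf R F ≃ₗ[R] ⨁ i, M i)
    (hdiv : ∀ r : R, r ≠ 0 → ∀ i, ∀ x : M i, ∃ y, r • y = x)
    (hann : ∀ (b c : R) (w : integralClosure R F), algebraMap R _ c = algebraMap R _ b * w →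
      ∀ i, ∀ x : M i, b • x = 0 → c • x = 0) :
    HasDivisibleValuativeNormalization R F where
  isDiscreteValuationRing := inferInstance
  exists_eq_add_mul r hr y := by
    obtain ⟨z, hz⟩ := DirectSum.exists_smul_eq (hdiv r hr) (e (Submodule.Quotient.mk y))
    obtain ⟨x, rfl⟩ := e.surjective z
    obtain ⟨z, rfl⟩ := Submodule.Quotient.mk_surjective _ x
    rw [← map_smul] at hz
    have hz := e.injective hz
    rw [← Submodule.Quotient.mk_smul, eq_comm, Submodule.Quotient.eq] at hz
    obtain ⟨s, hs⟩ := hz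
    exact ⟨s, z, by rw [← Algebra.smul_def, ← sub_eq_iff_eq_add]; exact hs.symm⟩
  exists_mul_eq b c w y hw p hp := by
    have h1 : b • (Submodule.Quotient.mk y : NormalizationModSelf R F) = 0 := by
      rw [← Submodule.Quotient.mk_smul, Submodule.Quotient.mk_eq_zero]
      exact ⟨p, by rw [Algebra.smul_def, hp]; rfl⟩
    have h2 := DirectSum.smul_eq_zero_of_forall (hann b c w hw) (e (Submodule.Quotient.mk y))
      (by rw [← map_smul, h1, map_zero])
    rw [← map_smul, LinearEquiv.map_eq_zero_iff, ← Submodule.Quotient.mk_smul,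
      Submodule.Quotient.mk_eq_zero] at h2
    obtain ⟨s, hs⟩ := h2
    exact ⟨s, by rw [← Algebra.smul_def]; exact hs.symm⟩

theorem of_linearEquiv_fieldModNormalization [IsDiscreteValuationRing (integralClosure R F)]
    {ι : Type*} (e : NormalizationModSelf R F ≃ₗ[R] ⨁ _ : ι, FieldModNormalization R F) :
    HasDivisibleValuativeNormalization R F := by
  refine of_linearEquiv_directSum e (fun r hr _ q => fieldModNormalization_exists_smul_eq hr q) ?_
  intro b c w hw _ x hx
  obtain ⟨z, rfl⟩ := Submodule.Quotient.mk_surjective _ x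
  rw [← Submodule.Quotient.mk_smul, Submodule.Quotient.mk_eq_zero] at hx ⊢
  have hw' : algebraMap R F c = algebraMap R F b * w := congrArg Subtype.val hw
  have : c • z = w * (b • z) := by
    rw [Algebra.smul_def, Algebra.smul_def, hw']; ring
  rw [this]
  exact (integralClosure R F).mul_mem w.2 hx

theorem of_isDirectSumOfDivisibleArtinianUniserial
    [IsDiscreteValuationRing (integralClosure R F)] {ι : Type*} [DecidableEq ι]
    {N : ι → Submodule R (NormalizationModSelf R F)}
    (hN : IsDirectSumOfDivisibleArtinianUniserial R N) :
    HasDivisibleValuativeNormalization R F := by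
  refine of_linearEquiv_directSum
    (LinearEquiv.ofBijective (DirectSum.coeLinearMap N) hN.1).symm ?_ ?_
  · intro r hr i x
    obtain ⟨y, hy⟩ := (hN.2 i).1 r (mem_nonZeroDivisors_of_ne_zero hr) x
    exact ⟨y, hy.symm⟩
  · intro b c w hw i x hx
    exact smul_eq_zero_of_uniserial (hN.2 i).1 (hN.2 i).2.2 hw x hx

/-- With `g = a / b` and `w = r + b z`, one has `w g ≡ r g` modulo `V`. Hence the `R`-submodules of
`F/V` are its `V`-submodules, and divisibility in the DVR governs them. -/
theorem mk_mul_mem_span (h : HasDivisibleValuativeNormalization R F) (w : integralClosure R F)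
    (g : F) : (Submodule.Quotient.mk (w * g) : FieldModNormalization R F)
      ∈ Submodule.span R {(Submodule.Quotient.mk g : FieldModNormalization R F)} := by
  obtain ⟨a, b, hb, rfl⟩ := IsFractionRing.div_surjective (A := R) g
  have hb0 : algebraMap R F b ≠ 0 := IsFractionRing.to_map_ne_zero_of_mem_nonZeroDivisors hb
  obtain ⟨r, z, hz⟩ := h.exists_eq_add_mul b (nonZeroDivisors.ne_zero hb) w
  have hz' : (w : F) = algebraMap R F r + algebraMap R F b * z := congrArg Subtype.val hz
  refine Submodule.mem_span_singleton.mpr ⟨r, ?_⟩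
  rw [← Submodule.Quotient.mk_smul, eq_comm, Submodule.Quotient.eq]
  have : (w : F) * (algebraMap R F a / algebraMap R F b)
      - r • (algebraMap R F a / algebraMap R F b) = algebraMap R F a * z := by
    rw [Algebra.smul_def, hz']
    field_simp
    ring
  rw [this]
  exact (integralClosure R F).mul_mem ((integralClosure R F).algebraMap_mem a) z.2

theorem isUniserialModule_fieldModNormalization (h : HasDivisibleValuativeNormalization R F) :
    IsUniserialModule R (FieldModNormalization R F) := by
  have := h.isDiscreteValuationRing
  have := IsFractionRing.integralClosure_self (R := R) (F := F)
  have key : ∀ x y : FieldModNormalization R F,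
      x ∈ Submodule.span R {y} ∨ y ∈ Submodule.span R {x} := by
    intro x y
    obtain ⟨f, rfl⟩ := Submodule.Quotient.mk_surjective _ x
    obtain ⟨g, rfl⟩ := Submodule.Quotient.mk_surjective _ y
    by_cases hf : f = 0
    · left; rw [hf]; exact zero_mem _
    by_cases hg : g = 0
    · right; rw [hg]; exact zero_mem _
    rcases ValuationRing.isInteger_or_isInteger (integralClosure R F) (f / g) with
      ⟨w, hw⟩ | ⟨w, hw⟩
    · left
      have hw : (w : F) = f / g := hw
      have := h.mk_mul_mem_span w g
      rwa [hw, div_mul_cancel₀ _ hg] at this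
    · right
      have hw : (w : F) = (f / g)⁻¹ := hw
      have := h.mk_mul_mem_span w f
      rwa [hw, inv_div, div_mul_cancel₀ _ hf] at this
  intro A B
  by_contra! hAB
  obtain ⟨x, hxA, hxB⟩ := SetLike.not_le_iff_exists.mp hAB.1
  obtain ⟨y, hyB, hyA⟩ := SetLike.not_le_iff_exists.mp hAB.2
  rcases key x y with hx | hy
  · exact hxB ((Submodule.span_singleton_le_iff_mem _ _).mpr hyB hx)
  · exact hyA ((Submodule.span_singleton_le_iff_mem _ _).mpr hxA hy)

theorem isArtinian_fieldModNormalization [IsLocalRing R]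
    (h : HasDivisibleValuativeNormalization R F) : IsArtinian R (FieldModNormalization R F) := by
  have := h.isDiscreteValuationRing
  have := IsFractionRing.integralClosure_self (R := R) (F := F)
  obtain ⟨t, -, ht⟩ := h.exists_irreducible_algebraMap
  have ht0 : algebraMap R F t ≠ 0 := fun h0 => ht.ne_zero (Subtype.ext h0)
  let q : ℕ → FieldModNormalization R F := fun n => Submodule.Quotient.mk (algebraMap R F t ^ n)⁻¹
  have hq : ∀ m k, q m = t ^ k • q (m + k) := by
    intro m k
    simp only [q]
    rw [← Submodule.Quotient.mk_smul, Algebra.smul_def, map_pow, pow_add]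
    congr 1
    field_simp
  have hlow : ∀ (B : Submodule R (FieldModNormalization R F)) (m n : ℕ), m ≤ n → q n ∈ B →
      q m ∈ B := by
    intro B m n hmn hn
    obtain ⟨k, rfl⟩ := Nat.exists_eq_add_of_le hmn
    rw [hq m k]
    exact B.smul_mem _ hn
  have hsep : ∀ A B : Submodule R (FieldModNormalization R F), A < B → ∃ n, q n ∈ B ∧ q n ∉ A := by
    intro A B hAB
    obtain ⟨y, hyB, hyA⟩ := SetLike.exists_of_lt hAB
    obtain ⟨z, rfl⟩ := Submodule.Quotient.mk_surjective _ y
    have hzV : z ∉ integralClosure R F := fun hz => hyA (by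
      rw [(Submodule.Quotient.mk_eq_zero _).mpr hz]; exact zero_mem _)
    have hz0 : z ≠ 0 := by rintro rfl; exact hzV (zero_mem _)
    obtain ⟨n, u, hu⟩ := IsDiscreteValuationRing.exists_units_eq_smul_zpow_of_irreducible ht hz0
    have hu : z = ((u : integralClosure R F) : F) * algebraMap R F t ^ n := hu
    obtain ⟨k, rfl⟩ : ∃ k : ℕ, n = -(k : ℤ) := by
      rcases le_total 0 n with hn | hn
      · obtain ⟨k, rfl⟩ := Int.eq_ofNat_of_zero_le hn
        refine absurd ?_ hzV
        rw [hu, zpow_natCast]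
        exact mul_mem (Subtype.coe_prop _) (pow_mem ((integralClosure R F).algebraMap_mem t) k)
      · exact ⟨n.natAbs, by omega⟩
    rw [zpow_neg, zpow_natCast] at hu
    refine ⟨k, ?_, fun hk => hyA ?_⟩
    · have h1 := h.mk_mul_mem_span ((u⁻¹ : (integralClosure R F)ˣ) : integralClosure R F) z
      have h2 : (((u⁻¹ : (integralClosure R F)ˣ) : integralClosure R F) : F) * z
          = (algebraMap R F t ^ k)⁻¹ := by
        rw [hu, ← mul_assoc]
        have : (((u⁻¹ : (integralClosure R F)ˣ) : integralClosure R F) : F)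
            * ((u : integralClosure R F) : F) = 1 := congrArg Subtype.val u.inv_mul
        rw [this, one_mul]
      rw [h2] at h1
      exact (Submodule.span_singleton_le_iff_mem _ _).mpr hyB h1
    · rw [hu]
      exact (Submodule.span_singleton_le_iff_mem _ _).mpr hk (h.mk_mul_mem_span _ _)
  -- A submodule is measured by the least `n` with the class of `t⁻ⁿ` outside it, infinite if there
  -- is none; strict monotonicity into the well-ordered `ℕ∞` gives the descending chain condition.
  let ρ : Submodule R (FieldModNormalization R F) → ℕ∞ := fun A =>
    sInf ((fun n : ℕ => (n : ℕ∞)) '' {n | q n ∉ A})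
  have hρ : StrictMono ρ := by
    intro A B hAB
    obtain ⟨n, hnB, hnA⟩ := hsep A B hAB
    have h1 : ρ A ≤ n := sInf_le ⟨n, hnA, rfl⟩
    have h2 : ((n + 1 : ℕ) : ℕ∞) ≤ ρ B := by
      refine le_sInf ?_
      rintro _ ⟨k, hk, rfl⟩
      refine Nat.cast_le.mpr (Nat.succ_le_of_lt (lt_of_not_ge fun hkn => hk ?_))
      exact hlow B k n hkn hnB
    exact h1.trans_lt ((Nat.cast_lt.mpr n.lt_succ_self).trans_le h2)
  exact hρ.wellFoundedLT

theorem _root_.IsUniserialModule.of_linearEquiv {R M N : Type*} [CommRing R] [AddCommGroup M]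
    [Module R M] [AddCommGroup N] [Module R N] (e : M ≃ₗ[R] N) (h : IsUniserialModule R M) :
    IsUniserialModule R N := by
  intro A B
  have hsurj := e.surjective
  refine (h (A.comap e.toLinearMap) (B.comap e.toLinearMap)).imp ?_ ?_ <;>
  · intro hle
    rwa [Submodule.comap_le_comap_iff_of_surjective hsurj] at hle

theorem exists_isDirectSumOfDivisibleArtinianUniserial [IsLocalRing R]
    (h : HasDivisibleValuativeNormalization R F) :
    ∃ (I : Type v) (_ : DecidableEq I) (N : I → Submodule R (NormalizationModSelf R F)),
      IsDirectSumOfDivisibleArtinianUniserial R N := by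
  classical
  obtain ⟨I, ⟨e⟩⟩ := h.exists_normalizationModSelf_linearEquiv
  let ℓ : ∀ i : I, FieldModNormalization R F →ₗ[R] NormalizationModSelf R F := fun i =>
    e.symm.toLinearMap ∘ₗ DirectSum.lof R I (fun _ => FieldModNormalization R F) i
  have hℓ : ∀ i, Function.Injective (ℓ i) := fun i =>
    e.symm.injective.comp (DirectSum.of_injective i)
  let g : ∀ i, FieldModNormalization R F ≃ₗ[R] LinearMap.range (ℓ i) := fun i =>
    LinearEquiv.ofInjective (ℓ i) (hℓ i)
  refine ⟨I, inferInstance, fun i => LinearMap.range (ℓ i), ?_, fun i => ⟨?_, ?_, ?_⟩⟩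
  · have hcomp : DirectSum.coeLinearMap (fun i => LinearMap.range (ℓ i)) ∘ₗ
        (DFinsupp.mapRange.linearEquiv g).toLinearMap = e.symm.toLinearMap := by
      refine DirectSum.linearMap_ext R fun i => LinearMap.ext fun q => ?_
      change DirectSum.coeLinearMap (fun i => LinearMap.range (ℓ i))
        (DFinsupp.mapRange.linearEquiv g (DFinsupp.single i q)) = ℓ i q
      have : DFinsupp.mapRange.linearEquiv g (DFinsupp.single i q)
          = DirectSum.lof R I (fun i => LinearMap.range (ℓ i)) i (g i q) :=
        DFinsupp.mapRange_single (hf := fun i => map_zero (g i))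
      rw [this]
      exact DirectSum.coeLinearMap_lof _ _ _
    have hfun : ⇑(DirectSum.coeLinearMap (fun i => LinearMap.range (ℓ i)))
        = e.symm ∘ (DFinsupp.mapRange.linearEquiv g).symm := by
      funext z
      obtain ⟨y, rfl⟩ := (DFinsupp.mapRange.linearEquiv g).surjective z
      rw [Function.comp_apply, LinearEquiv.symm_apply_apply]
      exact LinearMap.congr_fun hcomp y
    change Function.Bijective (DirectSum.coeLinearMap (fun i => LinearMap.range (ℓ i)))
    rw [hfun]
    exact e.symm.bijective.comp (LinearEquiv.bijective _)
  · intro r hr x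
    obtain ⟨y, hy⟩ := fieldModNormalization_exists_smul_eq (nonZeroDivisors.ne_zero hr)
      ((g i).symm x)
    exact ⟨g i y, by rw [← map_smul, hy, LinearEquiv.apply_symm_apply]⟩
  · have := h.isArtinian_fieldModNormalization
    exact isArtinian_of_linearEquiv (g i)
  · exact h.isUniserialModule_fieldModNormalization.of_linearEquiv (g i)

end HasDivisibleValuativeNormalization

/-! ### The equivalence -/

theorem theorem4p2 (R : Type u) (F : Type v) [CommRing R] [IsDomain R] [IsLocalRing R]
    [Field F] [Algebra R F] [IsFractionRing R F] (hR : ¬ IsDiscreteValuationRing R) :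
    List.TFAE [
      IsBadStableDomain R,
      IsDiscreteValuationRing (integralClosure R F) ∧
        ∃ I : Type v, Nonempty
          (NormalizationModSelf R F ≃ₗ[R] ⨁ _ : I, FieldModNormalization R F),
      IsDiscreteValuationRing (integralClosure R F) ∧
        ∃ (I : Type v) (_ : DecidableEq I) (N : I → Submodule R (NormalizationModSelf R F)),
          IsDirectSumOfDivisibleArtinianUniserial R N] := by
  tfae_have 1 → 2 := fun h => by
    have hX : HasDivisibleValuativeNormalization R F := .of_isBadStableDomain h
    exact ⟨hX.isDiscreteValuationRing, hX.exists_normalizationModSelf_linearEquiv⟩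
  tfae_have 2 → 3 := by
    rintro ⟨hV, I, ⟨e⟩⟩
    exact ⟨hV, (HasDivisibleValuativeNormalization.of_linearEquiv_fieldModNormalization
      e).exists_isDirectSumOfDivisibleArtinianUniserial⟩
  tfae_have 3 → 1 := by
    rintro ⟨hV, I, _, N, hN⟩
    exact (HasDivisibleValuativeNormalization.of_isDirectSumOfDivisibleArtinianUniserial
      hN).isBadStableDomain hR
  tfae_finish
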